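/- A tangled-diagram on $[n]=\{1,\dots,n\}$ is a labeled graph on $[n]$, with loops and multiple arcs allowed, all of whose vertices have degree $\le 2$ (a loop contributes $2$ to the degree), drawn with its vertices on a horizontal line and its arcs $(i,j)$, $i\le j$, in the upper halfplane. Two arcs without common endpoint cross if and only if, up to exchanging them, they are $(i_1,j_1),(i_2,j_2)$ with $i_1<i_2<j_1<j_2$. Each pair of different arcs with a common endpoint (including two parallel arcs $(i,j),(i,j)$) can be drawn in exactly two ways, crossing or not crossing, and this choice is part of the tangled-diagram. A tangled-diagram is $k$-noncrossing if it contains no $k$ mutually crossing arcs, a vertex is isolated if it has degree $0$, and a matching on $m$ points is a tangled-diagram on $[m]$ in which every vertex has degree $1$. Let $\tilde D_{2,k}(n)$ be the number of $k$-noncrossing tangled-diagrams on $[n]$ without isolated points, and let $f_k(m)$ be the number of $k$-noncrossing matchings on $m$ points (so $f_k(m)=0$ for odd $m$). Then for all $k$ and $n$ $$\tilde D_{2,k}(n)=\sum_{\ell=0}^{n}\binom{n}{\ell}\,f_k(2n-\ell).$$ In particular, for $k=3$, with $C_m=\frac{1}{m+1}\binom{2m}{m}$ the $m$-th Catalan number,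 $$\tilde D_{2,3}(n)=\sum_{\substack{0\le\ell\le n\\ \ell\ \mathrm{even}}}\binom{n}{\ell}\left(C_{\frac{2n-\ell}{2}}\,C_{\frac{2n-\ell}{2}+2}-C_{\frac{2n-\ell}{2}+1}^{2}\right).$$ -/

import Mathlib

/-- A tangled-diagram over the vertices `0 < 1 < ⋯ < n - 1` (playing the role of `1, …, n`): a
labeled graph, in which loops and multiple arcs are allowed, with all degrees at most `2` (a loop
contributes `2` to the degree of its vertex), together with the way it is drawn in the upper
halfplane.  Arcs are pairs `(i, j)` with `i ≤ j`.  Two arcs without common endpoint can be drawn in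
one way only.  Two different arcs (possibly parallel copies `(i, j), (i, j)`) with a common
endpoint can be drawn in exactly two ways, crossing or not crossing; `crossed` is the set of
those pairs which are drawn crossing. -/
@[ext]
structure TangledDiagram (n : ℕ) where
  /-- The arcs, with multiplicity. -/
  arcs : Multiset (Fin n × Fin n)
  /-- An arc is written with its lefthand endpoint first. -/
  fst_le_snd : ∀ a ∈ arcs, a.1 ≤ a.2
  /-- Every vertex has degree at most `2`. -/
  degree_le_two : ∀ v : Fin n,
    (arcs.map Prod.fst).count v + (arcs.map Prod.snd).count v ≤ 2
  /-- The unordered pairs of arcs with a common endpoint that are drawn crossing. -/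
  crossed : Finset (Sym2 (Fin n × Fin n))
  /-- Only two different arcs of the diagram (as members of the multiset, so that
  `a = b` needs a double arc) with a common endpoint are subject to this choice. -/
  adjacent_of_crossed : ∀ a b, s(a, b) ∈ crossed →
    {a, b} ≤ arcs ∧ (a.1 = b.1 ∨ a.2 = b.2 ∨ a.2 = b.1 ∨ b.2 = a.1)

namespace TangledDiagram

variable {n : ℕ}

/-- The degree of a vertex; a loop contributes `2`. -/
def degree (G : TangledDiagram n) (v : Fin n) : ℕ :=
  (G.arcs.map Prod.fst).count v + (G.arcs.map Prod.snd).count v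

/-- Two arcs of `G` cross: either `i₁ < i₂ < j₁ < j₂` (up to exchanging the arcs), or they have a
common endpoint and are drawn crossing. -/
def Crossing (G : TangledDiagram n) (a b : Fin n × Fin n) : Prop :=
  (a.1 < b.1 ∧ b.1 < a.2 ∧ a.2 < b.2) ∨ (b.1 < a.1 ∧ a.1 < b.2 ∧ b.2 < a.2) ∨ s(a, b) ∈ G.crossed

/-- `G` is `k`-noncrossing: it contains no `k` mutually crossing arcs.  Parallel arcs are different
arcs, hence families of arcs are submultisets of `G.arcs`. -/
def IsNoncrossing (k : ℕ) (G : TangledDiagram n) : Prop :=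
  ∀ S : Multiset (Fin n × Fin n), S ≤ G.arcs → S.card = k → ¬ S.Pairwise G.Crossing

/-- `G` has no isolated points. -/
def NoIsolated (G : TangledDiagram n) : Prop := ∀ v, G.degree v ≠ 0

/-- `G` is a matching, i.e. it is `1`-regular. -/
def IsMatching (G : TangledDiagram n) : Prop := ∀ v, G.degree v = 1

/-- There are only finitely many tangled-diagrams, so that the cardinalities below are genuine. -/
instance instFinite : Finite (TangledDiagram n) := by
  classical
  have key : ∀ G : TangledDiagram n,
      G.arcs ∈ Set.Iic (2 • (Finset.univ : Finset (Fin n × Fin n)).val) := by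
    intro G
    rw [Set.mem_Iic, Multiset.le_iff_count]
    intro a
    have h1 : G.arcs.count a ≤ (G.arcs.map Prod.fst).count a.1 := by
      have h := Multiset.map_le_map (f := Prod.fst)
        (Multiset.le_count_iff_replicate_le.mp (le_refl (G.arcs.count a)))
      rw [Multiset.map_replicate] at h
      exact Multiset.le_count_iff_replicate_le.mpr h
    have h2 := G.degree_le_two a.1
    rw [Multiset.count_nsmul, Multiset.count_univ]
    omega
  have hfin : (Set.Iic (2 • (Finset.univ : Finset (Fin n × Fin n)).val)).Finite :=
    Set.finite_Iic _
  have := hfin.to_subtype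
  refine Finite.of_injective
    (fun G : TangledDiagram n =>
      ((⟨G.arcs, key G⟩ : Set.Iic (2 • (Finset.univ : Finset (Fin n × Fin n)).val)), G.crossed)) ?_
  intro G H h
  simp only [Prod.mk.injEq, Subtype.mk.injEq] at h
  exact TangledDiagram.ext h.1 h.2

end TangledDiagram

/-- The number of `k`-noncrossing tangled-diagrams over `n` vertices without isolated points. -/
noncomputable def numTangledNoIsolated (k n : ℕ) : ℕ :=
  Nat.card {G : TangledDiagram n // G.IsNoncrossing k ∧ G.NoIsolated}

/-- The number of `k`-noncrossing matchings over `m` vertices. -/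
noncomputable def numMatchings (k m : ℕ) : ℕ :=
  Nat.card {G : TangledDiagram m // G.IsNoncrossing k ∧ G.IsMatching}

/-! Split every vertex of degree two into two consecutive points. A tangled-diagram with degree
function `d` becomes a perfect matching of its half-edges, and the order of the two half-edges at a
split vertex records whether the two arcs meeting there cross. Exchanging these two half-edges keeps
the multiset of arcs and toggles exactly this one crossing. Hence any matching that realizes the
arcs can be corrected one pair at a time, and arcs and crossings together determine the matching.
Mutually crossing families correspond, so for each `d` the `k`-noncrossing diagrams are equinumerous
with the `k`-noncrossing matchings on `∑ v, d v` points (`card_tangledDiagram_degree_eq`). Without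
isolated points `d` is given by the set of vertices of degree one; a set of size `l` leaves `2 * n -
l` points, which gives the binomial sum.

For `k = 3` a matching is read from left to right, and the open arcs are recorded by a standard
Young tableau with at most two rows. Closing an arc removes an entry, opening one is a Schensted
insertion, and a third row would appear exactly when three arcs cross. The shape therefore performs
a walk from the empty shape to itself in which each step adds or removes a box (`withWord_succ`). In
the coordinates sum and difference of the row lengths, both coordinates change by `±1`
independently, subject to `u ≥ v ≥ 0`. Such walks are counted by a determinant of
reflection-principle numbers (`ncard_withWord`), which for walks from the origin to itself is the
stated Catalan expression (`walkPairs_two_mul`). -/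

/-! ### Matchings as fixed-point-free involutions. -/

/-- `p` is an involution without fixed points. -/
def IsFPFInvolution {α : Type*} (p : α → α) : Prop := (∀ x, p (p x) = x) ∧ ∀ x, p x ≠ x

/-- The arcs `(x, p x)`, `x < p x`, of the involution `p` contain no `k` mutually crossing ones. -/
def IsNoncrossingInvolution {α : Type*} [LinearOrder α] (k : ℕ) (p : α → α) : Prop :=
  ∀ T : Finset α, T.card = k → (∀ x ∈ T, x < p x) →
    ¬ ∀ x ∈ T, ∀ y ∈ T, x < y → y < p x ∧ p x < p y

/-- The `k`-noncrossing involutions without fixed points of a linear order. -/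
def NoncrossingInvolution (k : ℕ) (α : Type*) [LinearOrder α] : Type _ :=
  {p : α → α // IsFPFInvolution p ∧ IsNoncrossingInvolution k p}

lemma IsNoncrossingInvolution.conj {α β : Type*} [LinearOrder α] [LinearOrder β] (e : α ≃o β)
    {k : ℕ} {p : α → α} (h : IsNoncrossingInvolution k p) :
    IsNoncrossingInvolution k (fun y => e (p (e.symm y))) := by
  intro T hT ho hc
  refine h (T.map e.symm.toEquiv.toEmbedding) (by simpa using hT) ?_ ?_
  · intro x hx
    obtain ⟨y, hy, rfl⟩ := Finset.mem_map.1 hx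
    have := ho y hy
    rw [← e.symm.lt_iff_lt] at this
    simpa using this
  · intro x hx x' hx' hlt
    obtain ⟨y, hy, rfl⟩ := Finset.mem_map.1 hx
    obtain ⟨y', hy', rfl⟩ := Finset.mem_map.1 hx'
    have := hc y hy y' hy' (e.symm.lt_iff_lt.1 hlt)
    rw [← e.symm.lt_iff_lt, e.lt_iff_lt] at this
    simpa using this

lemma card_noncrossingInvolution_congr {α β : Type*} [LinearOrder α] [LinearOrder β] (e : α ≃o β)
    (k : ℕ) : Nat.card (NoncrossingInvolution k α) = Nat.card (NoncrossingInvolution k β) := by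
  refine Nat.card_congr
    { toFun := fun p => ⟨fun y => e (p.1 (e.symm y)), ⟨fun y => by simp [p.2.1.1], fun y h =>
        p.2.1.2 (e.symm y) (by simpa using congrArg e.symm h)⟩, p.2.2.conj e⟩
      invFun := fun p => ⟨fun y => e.symm (p.1 (e y)), ⟨fun y => by simp [p.2.1.1], fun y h =>
        p.2.1.2 (e y) (by simpa using congrArg e h)⟩, p.2.2.conj e.symm⟩
      left_inv := fun p => by apply Subtype.ext; funext x; simp
      right_inv := fun p => by apply Subtype.ext; funext x; simp }

/-! ### Half-edges, and the arcs and crossings of a matching of them. -/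

/-- The half-edges of a graph with degrees `d`, in their order along the line: a vertex `v` of
degree `1` carries the point `2 * v`, and one of degree `2` the points `2 * v`, `2 * v + 1`. -/
abbrev HalfEdge {n : ℕ} (d : Fin n → ℕ) : Type :=
  {x : Fin (2 * n) // x.1 % 2 < d ⟨x.1 / 2, by omega⟩}

namespace HalfEdge

variable {n : ℕ} {d : Fin n → ℕ}

/-- The vertex to which a half-edge is attached. -/
def vtx (x : HalfEdge d) : Fin n := ⟨x.1.1 / 2, by omega⟩

/-- The position of a half-edge. -/
def pos (x : HalfEdge d) : ℕ := x.1.1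

lemma eq_iff {x y : HalfEdge d} : x = y ↔ x.pos = y.pos := by
  rw [Subtype.ext_iff, Fin.ext_iff]; rfl

lemma lt_iff {x y : HalfEdge d} : x < y ↔ x.pos < y.pos := Iff.rfl

lemma vtx_val (x : HalfEdge d) : (x.vtx : ℕ) = x.pos / 2 := rfl

lemma vtx_eq_iff {x y : HalfEdge d} : x.vtx = y.vtx ↔ x.pos / 2 = y.pos / 2 := by
  rw [Fin.ext_iff]; rfl

lemma pos_min (x y : HalfEdge d) : (min x y).pos = min x.pos y.pos := by
  rcases le_total x y with h | h
  · rw [min_eq_left h, min_eq_left (show x.pos ≤ y.pos from h)]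
  · rw [min_eq_right h, min_eq_right (show y.pos ≤ x.pos from h)]

lemma pos_max (x y : HalfEdge d) : (max x y).pos = max x.pos y.pos := by
  rcases le_total x y with h | h
  · rw [max_eq_right h, max_eq_right (show x.pos ≤ y.pos from h)]
  · rw [max_eq_left h, max_eq_left (show y.pos ≤ x.pos from h)]

lemma card_vtx_eq (hd : ∀ v, d v ≤ 2) (v : Fin n) :
    (Finset.univ.filter (fun x : HalfEdge d => x.vtx = v)).card = d v := by
  rw [← Finset.card_range (d v)]
  refine Finset.card_bij (fun x _ => x.pos % 2) ?_ ?_ ?_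
  · intro x hx
    have hv : x.vtx = v := by simpa using hx
    subst hv
    exact Finset.mem_range.2 x.2
  · intro x hx y hy h
    have hx : x.vtx = v := by simpa using hx
    have hy : y.vtx = v := by simpa using hy
    rw [eq_iff]
    have := vtx_eq_iff.1 (hx.trans hy.symm)
    omega
  · intro b hb
    have hb : b < d v := by simpa using hb
    have h2 := hd v
    have hv : (⟨(2 * v.1 + b) / 2, by omega⟩ : Fin n) = v := by
      ext; show (2 * v.1 + b) / 2 = v.1; omega
    refine ⟨⟨⟨2 * v.1 + b, by omega⟩, ?_⟩, ?_, ?_⟩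
    · show (2 * v.1 + b) % 2 < d ⟨(2 * v.1 + b) / 2, by omega⟩
      rw [hv]; omega
    · exact Finset.mem_filter.2 ⟨Finset.mem_univ _, hv⟩
    · show (2 * v.1 + b) % 2 = b
      omega

lemma card_eq (hd : ∀ v, d v ≤ 2) : Fintype.card (HalfEdge d) = ∑ v, d v := by
  rw [← Finset.card_univ, Finset.card_eq_sum_card_fiberwise (f := vtx) (t := Finset.univ)
    (fun _ _ => Finset.mem_coe.2 (Finset.mem_univ _))]
  exact Finset.sum_congr rfl fun v _ => card_vtx_eq hd v

/-- The arc at a half-edge, for the matching `p` of the half-edges. -/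
def arc (p : HalfEdge d → HalfEdge d) (x : HalfEdge d) : Fin n × Fin n :=
  ((min x (p x)).vtx, (max x (p x)).vtx)

/-- The arcs at the half-edges `x` and `y` cross, for the matching `p`. -/
def Cross (p : HalfEdge d → HalfEdge d) (x y : HalfEdge d) : Prop :=
  (min x.pos (p x).pos < min y.pos (p y).pos ∧ min y.pos (p y).pos < max x.pos (p x).pos ∧
    max x.pos (p x).pos < max y.pos (p y).pos) ∨
  (min y.pos (p y).pos < min x.pos (p x).pos ∧ min x.pos (p x).pos < max y.pos (p y).pos ∧
    max y.pos (p y).pos < max x.pos (p x).pos)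

lemma Cross.symm {p : HalfEdge d → HalfEdge d} {x y : HalfEdge d} (h : Cross p x y) :
    Cross p y x := Or.symm h

lemma arc_eq_iff {p q : HalfEdge d → HalfEdge d} {x y : HalfEdge d} :
    arc p x = arc q y ↔ (x.pos / 2 = y.pos / 2 ∧ (p x).pos / 2 = (q y).pos / 2) ∨
      (x.pos / 2 = (q y).pos / 2 ∧ (p x).pos / 2 = y.pos / 2) := by
  simp only [arc, Prod.mk.injEq, vtx_eq_iff, pos_min, pos_max]
  omega

/-- The left half-edges of the arcs. -/
def openers (p : HalfEdge d → HalfEdge d) : Finset (HalfEdge d) :=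
  Finset.univ.filter fun x => x < p x

/-- The arcs of the matching `p`. -/
def arcs (p : HalfEdge d → HalfEdge d) : Multiset (Fin n × Fin n) :=
  (openers p).val.map (arc p)

/-- Two distinct half-edges at the same vertex which are not matched with each other. -/
def Meet (p : HalfEdge d → HalfEdge d) (x y : HalfEdge d) : Prop :=
  x ≠ y ∧ y ≠ p x ∧ x.vtx = y.vtx

open Classical in
/-- The pairs of arcs with a common endpoint that cross, for the matching `p`. -/
noncomputable def crossed (p : HalfEdge d → HalfEdge d) : Finset (Sym2 (Fin n × Fin n)) :=
  (Finset.univ.filter fun x : HalfEdge d × HalfEdge d =>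
    Meet p x.1 x.2 ∧ Cross p x.1 x.2).image fun x => s(arc p x.1, arc p x.2)

lemma mem_crossed {p : HalfEdge d → HalfEdge d} {z : Sym2 (Fin n × Fin n)} :
    z ∈ crossed p ↔ ∃ x y, Meet p x y ∧ Cross p x y ∧ s(arc p x, arc p y) = z := by
  simp [crossed, and_assoc]

/-- What `IsFPFInvolution` says about the positions of two half-edges. -/
lemma pos_facts {p : HalfEdge d → HalfEdge d} (hp : IsFPFInvolution p) (x y : HalfEdge d) :
    (x.pos = y.pos ↔ (p x).pos = (p y).pos) ∧ ((p x).pos = y.pos ↔ x.pos = (p y).pos) ∧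
      (p x).pos ≠ x.pos := by
  simp only [← eq_iff, ne_eq, hp.2 x, not_false_eq_true, and_true]
  constructor
  · exact ⟨fun h => by rw [h], fun h => by rw [← hp.1 x, h, hp.1]⟩
  · exact ⟨fun h => by rw [← h, hp.1], fun h => by rw [h, hp.1]⟩

lemma cross_apply {p : HalfEdge d → HalfEdge d} (hp : IsFPFInvolution p) {x y : HalfEdge d} :
    Cross p (p x) (p y) ↔ Cross p x y := by
  simp only [Cross, hp.1, min_comm, max_comm]

/-- A pair of parallel arcs meets at two vertices, so the same unordered pair in `crossed` has two
possible witnesses. They agree: a vertex carries at most two half-edges, so the second witness is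
the first one up to order, or consists of its partners, and `Cross` does not see the difference. -/
lemma arc_unique_aux {p : HalfEdge d → HalfEdge d} (hp : IsFPFInvolution p) {x y x' y' : HalfEdge d}
    (h : Meet p x y) (h' : Meet p x' y') (hx : arc p x = arc p x') (hy : arc p y = arc p y') :
    Cross p x' y' → Cross p x y := by
  have key : (x' = x ∧ y' = y) ∨ (x' = y ∧ y' = x) ∨ (p x' = x ∧ p y' = y) ∨
      (p x' = y ∧ p y' = x) := by
    simp only [Meet, eq_iff, vtx_eq_iff, ne_eq] at h h' ⊢
    rw [arc_eq_iff] at hx hy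
    have h5 := (pos_facts hp x' y').1
    generalize x.pos = a at *
    generalize y.pos = b at *
    generalize (p x).pos = pa at *
    generalize (p y).pos = pb at *
    generalize (p x').pos = pa' at *
    generalize (p y').pos = pb' at *
    generalize x'.pos = a' at *
    generalize y'.pos = b' at *
    clear x y x' y' hp p
    -- Either the two pairs meet at the same vertex, or they meet at opposite ends of two parallel
    -- arcs.
    by_cases e : a' / 2 = a / 2
    · have h1 : a' = a ∨ a' = b := by clear hx hy h5; omega
      have h2 : b' = a ∨ b' = b := by clear hx hy h5; omega
      clear hx hy h5
      omega
    · have h1 : pa' / 2 = a / 2 := by clear hy h5; omega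
      have h2 : pb' / 2 = a / 2 := by clear hx h5; omega
      have h3 : pa' = a ∨ pa' = b := by clear hx hy h5; omega
      have h4 : pb' = a ∨ pb' = b := by clear hx hy h5; omega
      clear hx hy
      omega
  rcases key with ⟨rfl, rfl⟩ | ⟨rfl, rfl⟩ | ⟨rfl, rfl⟩ | ⟨rfl, rfl⟩
  · exact id
  · exact Cross.symm
  · exact (cross_apply hp).2
  · exact fun h => (cross_apply hp).2 h.symm

lemma Meet.symm {p : HalfEdge d → HalfEdge d} (hp : IsFPFInvolution p) {x y : HalfEdge d}
    (h : Meet p x y) : Meet p y x :=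
  ⟨h.1.symm, fun h' => h.2.1 (by rw [h', hp.1]), h.2.2.symm⟩

lemma mk_mem_crossed {p : HalfEdge d → HalfEdge d} (hp : IsFPFInvolution p) {x y : HalfEdge d}
    (h : Meet p x y) : s(arc p x, arc p y) ∈ crossed p ↔ Cross p x y := by
  rw [mem_crossed]
  refine ⟨?_, fun hc => ⟨x, y, h, hc, rfl⟩⟩
  rintro ⟨x', y', h', hc, he⟩
  rw [Sym2.eq_iff] at he
  rcases he with ⟨e1, e2⟩ | ⟨e1, e2⟩
  · exact arc_unique_aux hp h h' e1.symm e2.symm hc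
  · exact arc_unique_aux hp h (h'.symm hp) e2.symm e1.symm hc.symm

lemma mem_openers {p : HalfEdge d → HalfEdge d} {x : HalfEdge d} :
    x ∈ openers p ↔ x.pos < (p x).pos := by simp [openers, lt_iff]

lemma arc_apply {p : HalfEdge d → HalfEdge d} (hp : IsFPFInvolution p) (x : HalfEdge d) :
    arc p (p x) = arc p x := by
  simp only [arc, hp.1, min_comm, max_comm]

lemma arc_of_mem_openers {p : HalfEdge d → HalfEdge d} {x : HalfEdge d} (hx : x ∈ openers p) :
    arc p x = (x.vtx, (p x).vtx) := by
  have hx : x < p x := mem_openers.1 hx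
  simp only [arc, min_eq_left hx.le, max_eq_right hx.le]

lemma exists_opener {p : HalfEdge d → HalfEdge d} (hp : IsFPFInvolution p) (x : HalfEdge d) :
    ∃ x' ∈ openers p, (x' = x ∨ x' = p x) ∧ arc p x' = arc p x := by
  rcases lt_or_gt_of_ne (hp.2 x) with h | h
  · exact ⟨p x, by rw [mem_openers, hp.1]; exact h, Or.inr rfl, arc_apply hp x⟩
  · exact ⟨x, by rw [mem_openers]; exact h, Or.inl rfl, rfl⟩

lemma pair_le_arcs {p : HalfEdge d → HalfEdge d} {x y : HalfEdge d} (hx : x ∈ openers p)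
    (hy : y ∈ openers p) (h : x ≠ y) : {arc p x, arc p y} ≤ arcs p := by
  have : ({x, y} : Finset (HalfEdge d)).val ≤ (openers p).val := by
    rw [Finset.val_le_iff]
    intro z hz
    simp only [Finset.mem_insert, Finset.mem_singleton] at hz
    rcases hz with rfl | rfl <;> assumption
  have := Multiset.map_le_map (f := arc p) this
  rwa [Finset.insert_val_of_notMem (by simpa using h)] at this

lemma exists_of_pair_le_arcs {p : HalfEdge d → HalfEdge d} {a b : Fin n × Fin n}
    (h : {a, b} ≤ arcs p) : ∃ x ∈ openers p, ∃ y ∈ openers p, x ≠ y ∧ arc p x = a ∧ arc p y = b := by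
  have ha : a ∈ arcs p := Multiset.subset_of_le h (by simp)
  obtain ⟨x, hx, rfl⟩ := Multiset.mem_map.1 ha
  have h2 : (openers p).val = x ::ₘ ((openers p).erase x).val := by
    rw [Finset.erase_val, Multiset.cons_erase hx]
  have hb : b ∈ ((openers p).erase x).val.map (arc p) := by
    rw [arcs, h2, Multiset.map_cons, Multiset.insert_eq_cons, Multiset.cons_le_cons_iff] at h
    exact Multiset.subset_of_le h (by simp)
  obtain ⟨y, hy, rfl⟩ := Multiset.mem_map.1 hb
  have hy : y ∈ (openers p).erase x := hy
  rw [Finset.mem_erase] at hy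
  exact ⟨x, hx, y, hy.2, hy.1.symm, rfl, rfl⟩

/-- Left half-edges at `v` account for first components, and right half-edges, through their
partners, for second components; a loop supplies one of each. -/
lemma degree_arcs {p : HalfEdge d → HalfEdge d} (hp : IsFPFInvolution p) (hd : ∀ v, d v ≤ 2)
    (v : Fin n) : ((arcs p).map Prod.fst).count v + ((arcs p).map Prod.snd).count v = d v := by
  rw [← card_vtx_eq hd v]
  have h1 : ((arcs p).map Prod.fst).count v =
      (Finset.univ.filter fun x : HalfEdge d => x.vtx = v ∧ x < p x).card := by
    rw [arcs, Multiset.map_map, Multiset.count_map, ← Finset.filter_val, Finset.card_val]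
    congr 1
    ext x
    simp only [Finset.mem_filter, Finset.mem_univ, true_and, Function.comp, openers]
    constructor
    · rintro ⟨h, h'⟩
      rw [arc_of_mem_openers (by simpa [openers] using h)] at h'
      exact ⟨h'.symm, h⟩
    · rintro ⟨h', h⟩
      rw [arc_of_mem_openers (by simpa [openers] using h)]
      exact ⟨h, h'.symm⟩
  have h2 : ((arcs p).map Prod.snd).count v =
      (Finset.univ.filter fun x : HalfEdge d => x.vtx = v ∧ ¬ x < p x).card := by
    rw [arcs, Multiset.map_map, Multiset.count_map, ← Finset.filter_val, Finset.card_val]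
    refine Finset.card_bij (fun x _ => p x) ?_ ?_ ?_
    · intro x hx
      simp only [Finset.mem_filter, Finset.mem_univ, true_and, Function.comp] at hx ⊢
      have h := arc_of_mem_openers hx.1
      rw [h] at hx
      refine ⟨hx.2.symm, ?_⟩
      rw [hp.1]
      exact not_lt.2 (le_of_lt (mem_openers.1 hx.1))
    · intro x _ y _ h
      rw [← hp.1 x, h, hp.1]
    · intro y hy
      simp only [Finset.mem_filter, Finset.mem_univ, true_and, Function.comp] at hy ⊢
      have h : p y ∈ openers p := by
        rw [mem_openers, hp.1]
        exact lt_of_le_of_ne (not_lt.1 hy.2) (fun h => hp.2 y (eq_iff.2 h))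
      refine ⟨p y, ⟨h, ?_⟩, hp.1 y⟩
      rw [arc_of_mem_openers h, hp.1]
      exact hy.1.symm
  rw [h1, h2, ← Finset.card_filter_add_card_filter_not (s := Finset.univ.filter
    (fun x : HalfEdge d => x.vtx = v)) (p := fun x => x < p x),
    Finset.filter_filter, Finset.filter_filter]

end HalfEdge

/-! ### From matchings of half-edges to tangled-diagrams, with preservation of crossings. -/

namespace HalfEdge

variable {n : ℕ} {d : Fin n → ℕ}

lemma cross_apply_left {p : HalfEdge d → HalfEdge d} (hp : IsFPFInvolution p) {x y : HalfEdge d} :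
    Cross p (p x) y ↔ Cross p x y := by
  simp only [Cross, hp.1, min_comm (p x).pos, max_comm (p x).pos]

lemma cross_apply_right {p : HalfEdge d → HalfEdge d} (hp : IsFPFInvolution p) {x y : HalfEdge d} :
    Cross p x (p y) ↔ Cross p x y := by
  simp only [Cross, hp.1, min_comm (p y).pos, max_comm (p y).pos]

/-- The tangled-diagram with half-edges matched by `p`. -/
noncomputable def toTangledDiagram {p : HalfEdge d → HalfEdge d} (hp : IsFPFInvolution p)
    (hd : ∀ v, d v ≤ 2) : TangledDiagram n where
  arcs := arcs p
  fst_le_snd := by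
    intro a ha
    obtain ⟨x, hx, rfl⟩ := Multiset.mem_map.1 ha
    rw [arc_of_mem_openers hx]
    have := mem_openers.1 (show x ∈ openers p from hx)
    show x.pos / 2 ≤ (p x).pos / 2
    omega
  degree_le_two v := by rw [degree_arcs hp hd]; exact hd v
  crossed := crossed p
  adjacent_of_crossed := by
    intro a b h
    obtain ⟨x, y, hm, hc, he⟩ := mem_crossed.1 h
    obtain ⟨x', hx', hxx, hxe⟩ := exists_opener hp x
    obtain ⟨y', hy', hyy, hye⟩ := exists_opener hp y
    have hne : x' ≠ y' := by
      rintro rfl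
      rcases hxx with rfl | rfl <;> rcases hyy with h | h
      · exact hm.1 h
      · exact hm.2.1 (by rw [h, hp.1])
      · exact hm.2.1 h.symm
      · exact hm.1 (by rw [← hp.1 x, h, hp.1])
    have main : {arc p x, arc p y} ≤ arcs p ∧ ((arc p x).1 = (arc p y).1 ∨
        (arc p x).2 = (arc p y).2 ∨ (arc p x).2 = (arc p y).1 ∨ (arc p y).2 = (arc p x).1) := by
      refine ⟨by rw [← hxe, ← hye]; exact pair_le_arcs hx' hy' hne, ?_⟩
      have hv := vtx_eq_iff.1 hm.2.2
      simp only [arc, vtx_eq_iff, pos_min, pos_max]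
      omega
    rw [Sym2.eq_iff] at he
    rcases he with ⟨rfl, rfl⟩ | ⟨rfl, rfl⟩
    · exact main
    · refine ⟨by rw [Multiset.pair_comm]; exact main.1, ?_⟩
      have := main.2
      rcases this with h | h | h | h
      · exact Or.inl h.symm
      · exact Or.inr (Or.inl h.symm)
      · exact Or.inr (Or.inr (Or.inr h))
      · exact Or.inr (Or.inr (Or.inl h))

lemma crossing_iff {p : HalfEdge d → HalfEdge d} (hp : IsFPFInvolution p) (hd : ∀ v, d v ≤ 2)
    {x y : HalfEdge d} (hx : x ∈ openers p) (hy : y ∈ openers p) (hne : x ≠ y) :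
    (toTangledDiagram hp hd).Crossing (arc p x) (arc p y) ↔ Cross p x y := by
  have h1 := pos_facts hp x y
  have hx' := mem_openers.1 hx
  have hy' := mem_openers.1 hy
  have hne' : x.pos ≠ y.pos := fun h => hne (eq_iff.2 h)
  have hne2 : (p x).pos ≠ (p y).pos := fun h => hne' (h1.1.2 h)
  -- If the arcs share a vertex, whichever ends lie there witness membership in `crossed`. Otherwise
  -- all four ends lie at pairwise different vertices, except for the two ends of a loop, and
  -- comparing vertices amounts to comparing positions.
  have key : ∀ x' y', (x' = x ∨ x' = p x) → (y' = y ∨ y' = p y) → x'.vtx = y'.vtx →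
      (s(arc p x, arc p y) ∈ crossed p ↔ Cross p x y) := by
    intro x' y' ex ey hv
    have e1 : arc p x' = arc p x := by rcases ex with rfl | rfl; rfl; exact arc_apply hp x
    have e2 : arc p y' = arc p y := by rcases ey with rfl | rfl; rfl; exact arc_apply hp y
    have hm : Meet p x' y' := by
      refine ⟨?_, ?_, hv⟩ <;> rw [Ne, eq_iff] <;> rcases ex with rfl | rfl <;>
        rcases ey with rfl | rfl <;> try simp only [hp.1]
      all_goals omega
    rw [← e1, ← e2, mk_mem_crossed hp hm]
    rcases ex with rfl | rfl <;> rcases ey with rfl | rfl <;>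
      simp only [cross_apply_left hp, cross_apply_right hp]
  show ((arc p x).1 < (arc p y).1 ∧ (arc p y).1 < (arc p x).2 ∧ (arc p x).2 < (arc p y).2) ∨
    ((arc p y).1 < (arc p x).1 ∧ (arc p x).1 < (arc p y).2 ∧ (arc p y).2 < (arc p x).2) ∨
      s(arc p x, arc p y) ∈ crossed p ↔ Cross p x y
  by_cases hs : ∃ x' y', (x' = x ∨ x' = p x) ∧ (y' = y ∨ y' = p y) ∧ x'.vtx = y'.vtx
  · obtain ⟨x', y', ex, ey, hv⟩ := hs
    rw [key x' y' ex ey hv]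
    refine ⟨?_, fun h => Or.inr (Or.inr h)⟩
    rw [arc_of_mem_openers hx, arc_of_mem_openers hy]
    simp only [Fin.lt_def, vtx_val]
    unfold Cross
    rintro (h | h | h)
    · left; omega
    · right; omega
    · exact h
  · have hc : s(arc p x, arc p y) ∉ crossed p := by
      intro h
      obtain ⟨h2, h3⟩ := (toTangledDiagram hp hd).adjacent_of_crossed _ _ h
      rw [arc_of_mem_openers hx, arc_of_mem_openers hy] at h3
      rcases h3 with h | h | h | h
      · exact hs ⟨_, _, Or.inl rfl, Or.inl rfl, h⟩
      · exact hs ⟨_, _, Or.inr rfl, Or.inr rfl, h⟩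
      · exact hs ⟨_, _, Or.inr rfl, Or.inl rfl, h⟩
      · exact hs ⟨_, _, Or.inl rfl, Or.inr rfl, h.symm⟩
    have a1 : x.pos / 2 ≠ y.pos / 2 := fun h => hs ⟨_, _, Or.inl rfl, Or.inl rfl, vtx_eq_iff.2 h⟩
    have a2 : (p x).pos / 2 ≠ (p y).pos / 2 :=
      fun h => hs ⟨_, _, Or.inr rfl, Or.inr rfl, vtx_eq_iff.2 h⟩
    have a3 : (p x).pos / 2 ≠ y.pos / 2 :=
      fun h => hs ⟨_, _, Or.inr rfl, Or.inl rfl, vtx_eq_iff.2 h⟩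
    have a4 : x.pos / 2 ≠ (p y).pos / 2 :=
      fun h => hs ⟨_, _, Or.inl rfl, Or.inr rfl, vtx_eq_iff.2 h⟩
    rw [arc_of_mem_openers hx, arc_of_mem_openers hy] at *
    simp only [hc, or_false, Fin.lt_def, vtx_val, Cross]
    clear hc key hs h1
    omega

lemma exists_finset_of_le_arcs {p : HalfEdge d → HalfEdge d} {S : Multiset (Fin n × Fin n)}
    (h : S ≤ arcs p) : ∃ T ⊆ openers p, S = T.val.map (arc p) := by
  have : ∃ U ≤ (openers p).val, S = U.map (arc p) := by
    unfold arcs at h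
    induction S using Quotient.inductionOn with | _ l
    generalize (openers p).val = m at *
    induction m using Quotient.inductionOn with | _ m
    rw [Multiset.quot_mk_to_coe, Multiset.quot_mk_to_coe, Multiset.map_coe, Multiset.coe_le] at h
    obtain ⟨l', h1, h2⟩ := h
    obtain ⟨m', h3, rfl⟩ := List.sublist_map_iff.1 h2
    exact ⟨m', Multiset.coe_le.2 h3.subperm, by
      rw [Multiset.quot_mk_to_coe, Multiset.map_coe]; exact Multiset.coe_eq_coe.2 h1.symm⟩
  obtain ⟨U, hU, rfl⟩ := this
  exact ⟨⟨U, Multiset.nodup_of_le hU (openers p).nodup⟩, Finset.val_le_iff.1 hU, rfl⟩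

lemma isNoncrossing_iff {p : HalfEdge d → HalfEdge d} (hp : IsFPFInvolution p)
    (hd : ∀ v, d v ≤ 2) (k : ℕ) :
    (toTangledDiagram hp hd).IsNoncrossing k ↔ IsNoncrossingInvolution k p := by
  have hsymm : Std.Symm (toTangledDiagram hp hd).Crossing := by
    refine ⟨fun a b h => ?_⟩
    rcases h with h | h | h
    · exact Or.inr (Or.inl h)
    · exact Or.inl h
    · exact Or.inr (Or.inr (by rwa [Sym2.eq_swap]))
  have key : ∀ T : Finset (HalfEdge d), T ⊆ openers p →
      ((T.val.map (arc p)).Pairwise (toTangledDiagram hp hd).Crossing ↔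
        ∀ x ∈ T, ∀ y ∈ T, x < y → y < p x ∧ p x < p y) := by
    intro T hT
    have e : T.val.map (arc p) = ((T.toList.map (arc p) : List _) : Multiset _) := by
      rw [← Multiset.map_coe, Finset.coe_toList]
    rw [e, Multiset.pairwise_coe_iff_pairwise, List.pairwise_map]
    have hc : ∀ x ∈ T, ∀ y ∈ T, x ≠ y →
        ((toTangledDiagram hp hd).Crossing (arc p x) (arc p y) ↔ Cross p x y) :=
      fun x hx y hy hne => crossing_iff hp hd (hT hx) (hT hy) hne
    constructor
    · intro h x hx y hy hlt
      have : Std.Symm fun x y => (toTangledDiagram hp hd).Crossing (arc p x) (arc p y) :=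
        ⟨fun a b h => hsymm.symm _ _ h⟩
      have h1 := (hc x hx y hy hlt.ne).1
        (h.forall (Finset.mem_toList.2 hx) (Finset.mem_toList.2 hy) hlt.ne)
      have h2 := mem_openers.1 (hT hx)
      have h3 := mem_openers.1 (hT hy)
      rw [lt_iff] at hlt
      rw [lt_iff, lt_iff]
      unfold Cross at h1
      omega
    · intro h
      refine T.nodup_toList.pairwise_of_forall_ne fun x hx y hy hne => ?_
      rw [Finset.mem_toList] at hx hy
      rw [hc x hx y hy hne]
      have h2 := mem_openers.1 (hT hx)
      have h3 := mem_openers.1 (hT hy)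
      have h4 := h x hx y hy
      have h5 := h y hy x hx
      rw [Ne, eq_iff] at hne
      simp only [lt_iff] at h4 h5
      unfold Cross
      omega
  constructor
  · intro h T hT ho hc
    have hT' : T ⊆ openers p := fun x hx => mem_openers.2 (ho x hx)
    exact h (T.val.map (arc p)) (Multiset.map_le_map (Finset.val_le_iff.2 hT')) (by simpa using hT)
      ((key T hT').2 hc)
  · intro h S hS hk hc
    obtain ⟨T, hT, rfl⟩ := exists_finset_of_le_arcs (p := p) hS
    exact h T (by simpa using hk) (fun x hx => mem_openers.1 (hT hx)) ((key T hT).1 hc)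

end HalfEdge

/-! ### Arcs and crossings determine the matching; the exchange of two half-edges at a vertex. -/

namespace HalfEdge

variable {n : ℕ} {d : Fin n → ℕ}

/-- The right side depends on `p` only through `arcs p`, so two matchings with the same arcs join
the same vertices. For `v = u` both summands coincide, as each loop has two half-edges. -/
lemma card_vtx_vtx {p : HalfEdge d → HalfEdge d} (hp : IsFPFInvolution p) (v u : Fin n) :
    (Finset.univ.filter fun x : HalfEdge d => x.vtx = v ∧ (p x).vtx = u).card =
      (arcs p).count (v, u) + (arcs p).count (u, v) := by
  have h1 : (arcs p).count (v, u) = (Finset.univ.filter fun x : HalfEdge d =>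
      (x.vtx = v ∧ (p x).vtx = u) ∧ x < p x).card := by
    rw [arcs, Multiset.count_map, ← Finset.filter_val, Finset.card_val]
    congr 1
    ext x
    simp only [Finset.mem_filter, Finset.mem_univ, true_and]
    constructor
    · rintro ⟨h, h'⟩
      rw [arc_of_mem_openers h, Prod.mk.injEq] at h'
      exact ⟨⟨h'.1.symm, h'.2.symm⟩, mem_openers.1 h⟩
    · rintro ⟨⟨h, h'⟩, hx⟩
      have hx : x ∈ openers p := mem_openers.2 hx
      exact ⟨hx, by rw [arc_of_mem_openers hx, h, h']⟩
  have h2 : (arcs p).count (u, v) = (Finset.univ.filter fun x : HalfEdge d =>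
      (x.vtx = v ∧ (p x).vtx = u) ∧ ¬ x < p x).card := by
    rw [arcs, Multiset.count_map, ← Finset.filter_val, Finset.card_val]
    refine Finset.card_bij (fun x _ => p x) ?_ ?_ ?_
    · intro x hx
      simp only [Finset.mem_filter, Finset.mem_univ, true_and] at hx ⊢
      rw [arc_of_mem_openers hx.1, Prod.mk.injEq] at hx
      rw [hp.1]
      exact ⟨⟨hx.2.2.symm, hx.2.1.symm⟩, not_lt.2 (le_of_lt (mem_openers.1 hx.1))⟩
    · intro x _ y _ h
      rw [← hp.1 x, h, hp.1]
    · intro y hy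
      simp only [Finset.mem_filter, Finset.mem_univ, true_and] at hy ⊢
      have h : p y ∈ openers p := by
        rw [mem_openers, hp.1]
        exact lt_of_le_of_ne (not_lt.1 hy.2) (fun h => hp.2 y (eq_iff.2 h))
      refine ⟨p y, ⟨h, ?_⟩, hp.1 y⟩
      rw [arc_of_mem_openers h, hp.1, hy.1.1, hy.1.2]
  rw [h1, h2, ← Finset.card_filter_add_card_filter_not (s := Finset.univ.filter
    (fun x : HalfEdge d => x.vtx = v ∧ (p x).vtx = u)) (p := fun x => x < p x),
    Finset.filter_filter, Finset.filter_filter]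

lemma exists_vtx_of_arcs_eq {p q : HalfEdge d → HalfEdge d} (hp : IsFPFInvolution p)
    (hq : IsFPFInvolution q) (h : arcs p = arcs q) (x : HalfEdge d) :
    ∃ y, y.vtx = x.vtx ∧ (q y).vtx = (p x).vtx := by
  have h1 := card_vtx_vtx hp x.vtx (p x).vtx
  rw [h, ← card_vtx_vtx hq] at h1
  have h2 : 0 < (Finset.univ.filter fun y : HalfEdge d =>
      y.vtx = x.vtx ∧ (p y).vtx = (p x).vtx).card :=
    Finset.card_pos.2 ⟨x, by simp⟩
  rw [h1] at h2
  obtain ⟨y, hy⟩ := Finset.card_pos.1 h2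
  exact ⟨y, by simpa using hy⟩

/-- Where `p` and `q` differ, they differ by an exchange inside a vertex, at the near end or at the
far end of two arcs, and such an exchange would alter `crossed`. -/
lemma arcs_crossed_injective {p q : HalfEdge d → HalfEdge d} (hp : IsFPFInvolution p)
    (hq : IsFPFInvolution q) (h : arcs p = arcs q) (hc : crossed p = crossed q) : p = q := by
  -- If this fails at `x`, then the other half-edge `y` at the vertex of `x` has the two target
  -- vertices interchanged, so the same pair of arcs crosses for exactly one of `p`, `q`.
  have hv : ∀ x, (p x).vtx = (q x).vtx := by
    intro x
    by_contra hne
    obtain ⟨y, hy1, hy2⟩ := exists_vtx_of_arcs_eq hp hq h x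
    obtain ⟨z, hz1, hz2⟩ := exists_vtx_of_arcs_eq hq hp h.symm x
    have hyx : y ≠ x := by rintro rfl; exact hne hy2.symm
    have hzx : z ≠ x := by rintro rfl; exact hne hz2
    have hyz : y = z := by
      rw [vtx_eq_iff] at hy1 hz1
      rw [Ne, eq_iff] at hyx hzx
      rw [eq_iff]
      omega
    subst hyz
    have mp : Meet p x y := by
      refine ⟨hyx.symm, ?_, hy1.symm⟩
      rintro rfl
      rw [hp.1] at hz2
      exact hne (hy1.trans hz2)
    have mq : Meet q x y := by
      refine ⟨hyx.symm, ?_, hy1.symm⟩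
      rintro rfl
      rw [hq.1] at hy2
      exact hne (hy2.symm.trans hy1.symm)
    rw [vtx_eq_iff] at *
    have e1 : arc p x = arc q y := arc_eq_iff.2 (Or.inl ⟨hy1.symm, hy2.symm⟩)
    have e2 : arc p y = arc q x := arc_eq_iff.2 (Or.inl ⟨hy1, hz2⟩)
    have := mk_mem_crossed hp mp
    rw [e1, e2, hc, mk_mem_crossed hq (mq.symm hq)] at this
    have f1 := pos_facts hp x y
    have f2 := pos_facts hq x y
    simp only [Meet, Ne, eq_iff] at mp mq
    unfold Cross at this
    omega
  -- What remains is a disagreement at the far vertex. Then `q (p x)` and `p (q x)` are both the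
  -- companion `y` of `x`, so `x` and `y` carry parallel arcs, drawn crossing by one matching and
  -- noncrossing by the other.
  funext x
  by_contra hne
  have e1 : q (p x) ≠ x := fun h => hne (by rw [← hq.1 (p x), h])
  have e2 : p (q x) ≠ x := fun h => hne (by rw [← h, hp.1, h])
  have v1 := hv (p x)
  have v2 := hv (q x)
  have v3 := hv x
  rw [hp.1] at v1
  rw [hq.1] at v2
  have e3 : q (p x) = p (q x) := by
    rw [Ne, eq_iff] at e1 e2
    rw [vtx_eq_iff] at v1 v2
    rw [eq_iff]
    omega
  obtain ⟨y, hy⟩ : ∃ y, y = q (p x) := ⟨_, rfl⟩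
  have hqy : q y = p x := by rw [hy, hq.1]
  have hpy : p y = q x := by rw [hy, e3, hp.1]
  rw [← hy] at e1 v1
  have ne1 := hp.2 x
  have ne2 := hq.2 x
  have hxy : p x ≠ y := fun h => hq.2 y (hqy.trans h)
  have hxy' : q x ≠ y := fun h => hp.2 y (hpy.trans h)
  have mp : Meet p x y := ⟨e1.symm, hxy.symm, v1⟩
  have mq : Meet q x y := ⟨e1.symm, hxy'.symm, v1⟩
  have a1 : arc p x = arc q x := arc_eq_iff.2 (Or.inl ⟨rfl, vtx_eq_iff.1 v3⟩)
  have a2 : arc p y = arc q y := arc_eq_iff.2 (Or.inl ⟨rfl, vtx_eq_iff.1 (hv y)⟩)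
  have := mk_mem_crossed hp mp
  rw [a1, a2, hc, mk_mem_crossed hq mq] at this
  unfold Cross at this
  rw [hqy, hpy] at this
  simp only [Ne, eq_iff, vtx_eq_iff] at *
  clear hp hq h hc hv a1 a2 mp mq e3 e2
  omega

/-- Exchange the half-edges `x` and `y` in the matching `p`. -/
def swapAt (p : HalfEdge d → HalfEdge d) (x y : HalfEdge d) : HalfEdge d → HalfEdge d :=
  fun z => Equiv.swap x y (p (Equiv.swap x y z))

lemma IsFPFInvolution.swapAt {p : HalfEdge d → HalfEdge d} (hp : IsFPFInvolution p)
    (x y : HalfEdge d) : IsFPFInvolution (swapAt p x y) := by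
  refine ⟨fun z => by simp [HalfEdge.swapAt, hp.1], fun z h => hp.2 (Equiv.swap x y z) ?_⟩
  unfold HalfEdge.swapAt at h
  rw [← Equiv.swap_apply_self x y (p _), h]

lemma swapAt_swapAt (p : HalfEdge d → HalfEdge d) (x y : HalfEdge d) :
    swapAt (swapAt p x y) x y = p := by
  funext z; simp [swapAt]

lemma vtx_swap {x y : HalfEdge d} (h : x.vtx = y.vtx) (z : HalfEdge d) :
    (Equiv.swap x y z).vtx = z.vtx := by
  rw [Equiv.swap_apply_def]; split_ifs with h1 h2
  · rw [h1, h]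
  · rw [h2, h]
  · rfl

lemma arc_swapAt (p : HalfEdge d → HalfEdge d) {x y : HalfEdge d} (h : x.vtx = y.vtx)
    (z : HalfEdge d) : arc (swapAt p x y) z = arc p (Equiv.swap x y z) := by
  refine arc_eq_iff.2 (Or.inl ⟨?_, ?_⟩) <;> rw [← vtx_eq_iff]
  · rw [vtx_swap h]
  · rw [swapAt, vtx_swap h]

lemma eq_or_eq_of_vtx {x y z : HalfEdge d} (hxy : x ≠ y) (h : x.vtx = y.vtx)
    (hz : z.vtx = x.vtx) : z = x ∨ z = y := by
  rw [vtx_eq_iff] at h hz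
  rw [Ne, eq_iff] at hxy
  simp only [eq_iff]
  omega

/-- Moving half-edges inside a vertex can reverse an arc only if it is a loop there, and the vertex
of `x` and `y` has no loop because `x` and `y` are not matched with each other. -/
lemma openers_swapAt {p : HalfEdge d → HalfEdge d} (hp : IsFPFInvolution p) {x y : HalfEdge d}
    (h : Meet p x y) :
    openers (swapAt p x y) = (openers p).map (Equiv.swap x y).toEmbedding := by
  have key : ∀ w, Equiv.swap x y w < Equiv.swap x y (p w) ↔ w < p w := by
    intro w
    by_cases e : w.vtx = (p w).vtx
    · by_cases e' : w.vtx = x.vtx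
      · have h1 := eq_or_eq_of_vtx h.1 h.2.2 e'
        have h2 := eq_or_eq_of_vtx h.1 h.2.2 (e.symm.trans e')
        rcases h1 with rfl | rfl
        · rcases h2 with h2 | h2
          · exact absurd h2 (hp.2 _)
          · exact absurd h2.symm h.2.1
        · rcases h2 with h2 | h2
          · exact absurd (by rw [← h2, hp.1]) h.2.1
          · exact absurd h2 (hp.2 _)
      · have hy := h.2.2
        have n1 : w ≠ x := fun h => e' (by rw [h])
        have n2 : w ≠ y := fun h => e' (by rw [h, hy])
        have n3 : p w ≠ x := fun h => e' (by rw [e, h])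
        have n4 : p w ≠ y := fun h => e' (by rw [e, h, hy])
        rw [Equiv.swap_apply_of_ne_of_ne n1 n2, Equiv.swap_apply_of_ne_of_ne n3 n4]
    · have h1 := vtx_swap h.2.2 w
      have h2 := vtx_swap h.2.2 (p w)
      rw [vtx_eq_iff] at h1 h2 e
      rw [lt_iff, lt_iff]
      omega
  ext z
  have := key (Equiv.swap x y z)
  rw [Equiv.swap_apply_self] at this
  rw [Finset.mem_map_equiv, Equiv.symm_swap]
  simp only [openers, Finset.mem_filter, Finset.mem_univ, true_and]
  exact this

lemma arcs_swapAt {p : HalfEdge d → HalfEdge d} (hp : IsFPFInvolution p) {x y : HalfEdge d}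
    (h : Meet p x y) : arcs (swapAt p x y) = arcs p := by
  rw [arcs, openers_swapAt hp h, Finset.map_val, Multiset.map_map, arcs]
  refine Multiset.map_congr rfl fun z _ => ?_
  simp [arc_swapAt p h.2.2]

lemma swapAt_apply_left {p : HalfEdge d → HalfEdge d} (hp : IsFPFInvolution p) {x y : HalfEdge d}
    (h : Meet p x y) : swapAt p x y x = p y := by
  rw [swapAt, Equiv.swap_apply_left, Equiv.swap_apply_of_ne_of_ne ?_ (hp.2 y)]
  exact fun h' => h.2.1 (by rw [← h', hp.1])

lemma swapAt_apply_right {p : HalfEdge d → HalfEdge d} (hp : IsFPFInvolution p) {x y : HalfEdge d}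
    (h : Meet p x y) : swapAt p x y y = p x := by
  rw [swapAt, Equiv.swap_apply_right, Equiv.swap_apply_of_ne_of_ne (hp.2 x) h.2.1.symm]

lemma Meet.swapAt {p : HalfEdge d → HalfEdge d} (hp : IsFPFInvolution p) {x y : HalfEdge d}
    (h : Meet p x y) : Meet (swapAt p x y) x y :=
  ⟨h.1, by rw [swapAt_apply_left hp h]; exact (hp.2 y).symm, h.2.2⟩

/-- Since `x` and `y` are neighbours on the line, no other end separates them, and exchanging their
partners turns a crossing into a noncrossing and conversely. -/
lemma cross_swapAt {p : HalfEdge d → HalfEdge d} (hp : IsFPFInvolution p) {x y : HalfEdge d}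
    (h : Meet p x y) : Cross (swapAt p x y) x y ↔ ¬ Cross p x y := by
  have f1 := pos_facts hp x y
  have f2 := pos_facts hp y x
  unfold Cross
  rw [swapAt_apply_left hp h, swapAt_apply_right hp h]
  simp only [Meet, Ne, eq_iff, vtx_eq_iff] at h
  omega

/-- No end of the two arcs other than the moved one lies at the vertex of `s`, so shifting `s`
inside this vertex passes no other end. -/
lemma cross_positions_congr {a s s' b c : ℕ} (h : s / 2 = s' / 2) (hab : a / 2 = b / 2)
    (ha : a / 2 ≠ s / 2) (hc : c / 2 ≠ s / 2) :
    ((min a s < min b c ∧ min b c < max a s ∧ max a s < max b c) ∨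
      (min b c < min a s ∧ min a s < max b c ∧ max b c < max a s)) ↔
    ((min a s' < min b c ∧ min b c < max a s' ∧ max a s' < max b c) ∨
      (min b c < min a s' ∧ min a s' < max b c ∧ max b c < max a s')) := by
  have h1 : a < s ↔ a < s' := by omega
  have h2 : b < s ↔ b < s' := by omega
  have h3 : c < s ↔ c < s' := by omega
  have h4 : a ≠ s' := by omega
  have h5 : b ≠ s ∧ b ≠ s' ∧ c ≠ s ∧ c ≠ s' ∧ a ≠ s := by omega
  clear h hab ha hc
  rcases lt_or_gt_of_ne h5.2.2.2.2 with e | e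
  · rw [min_eq_left e.le, max_eq_right e.le, min_eq_left (h1.1 e).le, max_eq_right (h1.1 e).le]
    rcases le_total b c with f | f
    · rw [min_eq_left f, max_eq_right f]; omega
    · rw [min_eq_right f, max_eq_left f]; omega
  · have e' : s' < a := by omega
    rw [min_eq_right e.le, max_eq_left e.le, min_eq_right e'.le, max_eq_left e'.le]
    rcases le_total b c with f | f
    · rw [min_eq_left f, max_eq_right f]; omega
    · rw [min_eq_right f, max_eq_left f]; omega

/-- A pair meeting at another vertex has at most one end moved by the exchange; if both partners
were moved, it would be the excluded pair, seen from the far end of parallel arcs. -/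
lemma mem_crossed_of_swapAt {p : HalfEdge d → HalfEdge d} (hp : IsFPFInvolution p)
    {x y : HalfEdge d} (h : Meet p x y) {z : Sym2 (Fin n × Fin n)}
    (hz : z ≠ s(arc p x, arc p y)) (hm : z ∈ crossed (swapAt p x y)) : z ∈ crossed p := by
  obtain ⟨a, b, hab, hc, rfl⟩ := mem_crossed.1 hm
  rw [arc_swapAt p h.2.2, arc_swapAt p h.2.2] at hz ⊢
  by_cases ha : a.vtx = x.vtx
  · exfalso
    have h1 := eq_or_eq_of_vtx h.1 h.2.2 ha
    have h2 := eq_or_eq_of_vtx h.1 h.2.2 (hab.2.2.symm.trans ha)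
    rcases h1 with rfl | rfl <;> rcases h2 with rfl | rfl
    · exact hab.1 rfl
    · simp [Sym2.eq_swap] at hz
    · simp [Sym2.eq_swap] at hz
    · exact hab.1 rfl
  have hb : b.vtx ≠ x.vtx := fun h' => ha (hab.2.2.trans h')
  have ne : ∀ {c : HalfEdge d}, c.vtx ≠ x.vtx → c ≠ x ∧ c ≠ y := fun h' =>
    ⟨fun e => h' (by rw [e]), fun e => h' (by rw [e, h.2.2])⟩
  have sa : Equiv.swap x y a = a := Equiv.swap_apply_of_ne_of_ne (ne ha).1 (ne ha).2
  have sb : Equiv.swap x y b = b := Equiv.swap_apply_of_ne_of_ne (ne hb).1 (ne hb).2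
  rw [sa, sb] at hz ⊢
  have pa : swapAt p x y a = Equiv.swap x y (p a) := by rw [swapAt, sa]
  have pb : swapAt p x y b = Equiv.swap x y (p b) := by rw [swapAt, sb]
  have hab' : Meet p a b := by
    refine ⟨hab.1, fun e => hab.2.1 ?_, hab.2.2⟩
    rw [pa, ← e, sb]
  rw [mk_mem_crossed hp hab']
  unfold Cross at hc ⊢
  rw [pa, pb] at hc
  by_cases h1 : (p a).vtx = x.vtx <;> by_cases h2 : (p b).vtx = x.vtx
  · exfalso
    have h1 := eq_or_eq_of_vtx h.1 h.2.2 h1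
    have h2 := eq_or_eq_of_vtx h.1 h.2.2 h2
    rw [← arc_apply hp a, ← arc_apply hp b] at hz
    have hpab : p a ≠ p b := fun e => hab.1 (by rw [← hp.1 a, e, hp.1])
    rcases h1 with h1 | h1 <;> rcases h2 with h2 | h2
    · exact hpab (h1.trans h2.symm)
    · rw [h1, h2] at hz; exact hz rfl
    · rw [h1, h2] at hz; exact hz Sym2.eq_swap
    · exact hpab (h1.trans h2.symm)
  · have v := vtx_swap h.2.2 (p a)
    rw [Equiv.swap_apply_of_ne_of_ne (ne h2).1 (ne h2).2] at hc
    have hv := hab.2.2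
    simp only [vtx_eq_iff] at ha h1 h2 v hv
    refine (cross_positions_congr v hv ?_ ?_).1 hc
    · rwa [v, h1]
    · rwa [v, h1]
  · have v := vtx_swap h.2.2 (p b)
    rw [Equiv.swap_apply_of_ne_of_ne (ne h1).1 (ne h1).2] at hc
    have hv := hab.2.2
    simp only [Ne, vtx_eq_iff] at hb h1 h2 v hv
    refine ((cross_positions_congr v hv.symm ?_ ?_).1 (Or.symm hc)).symm
    · rwa [v, h2]
    · rwa [v, h2]
  · rwa [Equiv.swap_apply_of_ne_of_ne (ne h1).1 (ne h1).2,
      Equiv.swap_apply_of_ne_of_ne (ne h2).1 (ne h2).2] at hc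

lemma crossed_swapAt {p : HalfEdge d → HalfEdge d} (hp : IsFPFInvolution p) {x y : HalfEdge d}
    (h : Meet p x y) :
    crossed (swapAt p x y) = symmDiff (crossed p) {s(arc p x, arc p y)} := by
  have e : s(arc (swapAt p x y) x, arc (swapAt p x y) y) = s(arc p x, arc p y) := by
    rw [arc_swapAt p h.2.2, arc_swapAt p h.2.2, Equiv.swap_apply_left, Equiv.swap_apply_right,
      Sym2.eq_swap]
  ext z
  rw [Finset.mem_symmDiff, Finset.mem_singleton]
  by_cases hz : z = s(arc p x, arc p y)
  · have h1 := mk_mem_crossed hp h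
    have h2 := mk_mem_crossed (IsFPFInvolution.swapAt hp x y) (Meet.swapAt hp h)
    rw [e, cross_swapAt hp h, ← h1] at h2
    simp [hz, h2]
  · have h1 := mem_crossed_of_swapAt hp h hz
    have h2 := mem_crossed_of_swapAt (IsFPFInvolution.swapAt hp x y) (Meet.swapAt hp h)
      (z := z) (by rwa [e])
    rw [swapAt_swapAt] at h2
    simp only [hz, not_false_eq_true, and_true, false_and, or_false]
    exact ⟨h1, h2⟩

end HalfEdge

/-! ### Every tangled-diagram comes from a matching of its half-edges. -/

namespace HalfEdge

variable {n : ℕ} {d : Fin n → ℕ}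

/-- The ends of the arcs of `G` and the half-edges have equally many elements over each vertex, so
any bijection respecting the vertices transports the pairing of the two ends of each arc. Crossings
are ignored here and repaired by `exists_crossed_eq`. -/
lemma exists_arcs_eq (G : TangledDiagram n) (hd : ∀ v, d v ≤ 2) (hG : ∀ v, G.degree v = d v) :
    ∃ p : HalfEdge d → HalfEdge d, IsFPFInvolution p ∧ arcs p = G.arcs := by
  -- The coercion of the multiset `G.arcs` to a type keeps parallel copies apart.
  let ψ : G.arcs × Bool → Fin n := fun h => cond h.2 h.1.1.2 h.1.1.1
  have hcard : ∀ v, Fintype.card {h // ψ h = v} = d v := by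
    intro v
    rw [← hG v, TangledDiagram.degree, Fintype.card_subtype]
    have e1 : ∀ f : Fin n × Fin n → Fin n, (G.arcs.map f).count v =
        (Finset.univ.filter fun a : G.arcs => f a.1 = v).card := by
      intro f
      conv_lhs => rw [← G.arcs.map_univ_coe]
      rw [Multiset.map_map, Multiset.count_map, ← Finset.filter_val, Finset.card_val]
      congr 1
      ext a
      simp [eq_comm]
    rw [e1, e1, ← Finset.univ_product_univ, Finset.card_filter, Finset.sum_product,
      Finset.card_filter, Finset.card_filter, ← Finset.sum_add_distrib]
    refine Finset.sum_congr rfl fun a _ => ?_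
    rw [Fintype.sum_bool]
    exact add_comm _ _
  have hcard' : ∀ v, Fintype.card {x : HalfEdge d // x.vtx = v} = d v := by
    intro v
    rw [Fintype.card_subtype, card_vtx_eq hd]
  let e : G.arcs × Bool ≃ HalfEdge d := Equiv.ofFiberEquiv (f := ψ) (g := vtx)
    fun v => Fintype.equivOfCardEq ((hcard v).trans (hcard' v).symm)
  have he : ∀ h, (e h).vtx = ψ h := fun h => Equiv.ofFiberEquiv_map _ h
  have hp : IsFPFInvolution fun x => e ((e.symm x).1, !(e.symm x).2) := by
    refine ⟨fun x => by simp, fun x h => ?_⟩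
    have := congrArg Prod.snd (e.eq_symm_apply.2 h)
    simp at this
  refine ⟨_, hp, ?_⟩
  set p : HalfEdge d → HalfEdge d := fun x => e ((e.symm x).1, !(e.symm x).2) with hpdef
  have hpe : ∀ a b, p (e (a, b)) = e (a, !b) := fun a b => by simp [hpdef]
  have harc : ∀ a b, arc p (e (a, b)) = a.1 := by
    intro a b
    have h0 := G.fst_le_snd a.1 (Multiset.coe_mem)
    have h1 : (e (a, false)).vtx = a.1.1 := he _
    have h2 : (e (a, true)).vtx = a.1.2 := he _
    have key : arc p (e (a, false)) = a.1 := by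
      have h3 := (hpe a false)
      simp only [Bool.not_false] at h3
      -- For a loop the bijection may put its two ends in either order, whence the case split on
      -- `min` and `max`.
      rcases h0.eq_or_lt with h0 | h0
      · refine Prod.ext ?_ ?_
        · rw [arc, h3]
          rcases min_choice (e (a, false)) (e (a, true)) with h | h <;> rw [h]
          · exact h1
          · exact h2.trans h0.symm
        · rw [arc, h3]
          rcases max_choice (e (a, false)) (e (a, true)) with h | h <;> rw [h]
          · exact h1.trans h0
          · exact h2
      · rw [arc_of_mem_openers, h3, h1, h2]
        rw [← h1, ← h2, Fin.lt_def, vtx_val, vtx_val] at h0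
        rw [mem_openers, h3]
        omega
    cases b
    · exact key
    · rw [← key, ← arc_apply hp (e (a, false)), hpe, Bool.not_false]
  have hop : openers p = Finset.univ.image fun a => min (e (a, false)) (e (a, true)) := by
    ext x
    simp only [openers, Finset.mem_filter, Finset.mem_univ, true_and, Finset.mem_image]
    constructor
    · intro hx
      obtain ⟨⟨a, b⟩, rfl⟩ := e.surjective x
      rw [hpe] at hx
      refine ⟨a, ?_⟩
      cases b
      · exact min_eq_left hx.le
      · exact min_eq_right hx.le
    · rintro ⟨a, rfl⟩
      have hne : e (a, false) ≠ e (a, true) := fun h => by simpa using e.injective h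
      rcases lt_or_gt_of_ne hne with h | h
      · rw [min_eq_left h.le, hpe]; exact h
      · rw [min_eq_right h.le, hpe]; exact h
  have hinj : Function.Injective fun a => min (e (a, false)) (e (a, true)) := by
    intro a b h
    have key : ∀ c, (e.symm (min (e (c, false)) (e (c, true)))).1 = c := by
      intro c
      rcases min_choice (e (c, false)) (e (c, true)) with h | h <;> rw [h] <;> simp
    rw [← key a, ← key b]
    exact congrArg (fun z => (e.symm z).1) h
  rw [arcs, hop, Finset.image_val_of_injOn hinj.injOn, Multiset.map_map]
  conv_rhs => rw [← G.arcs.map_univ_coe]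
  refine Multiset.map_congr rfl fun a _ => ?_
  show arc p (min (e (a, false)) (e (a, true))) = a.1
  rcases min_choice (e (a, false)) (e (a, true)) with h | h <;> rw [h] <;> exact harc _ _

lemma exists_meet {G : TangledDiagram n} {p : HalfEdge d → HalfEdge d} (hp : IsFPFInvolution p)
    (h : arcs p = G.arcs) {z : Sym2 (Fin n × Fin n)} (hz : z ∈ crossed p ∨ z ∈ G.crossed) :
    ∃ x y, Meet p x y ∧ s(arc p x, arc p y) = z := by
  rcases hz with hz | hz
  · obtain ⟨x, y, hm, _, he⟩ := mem_crossed.1 hz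
    exact ⟨x, y, hm, he⟩
  · induction z using Sym2.inductionOn with | _ a b
    obtain ⟨h1, h2⟩ := G.adjacent_of_crossed a b hz
    rw [← h] at h1
    obtain ⟨x, hx, y, hy, hne, rfl, rfl⟩ := exists_of_pair_le_arcs h1
    have key : ∀ x' y', (x' = x ∨ x' = p x) → (y' = y ∨ y' = p y) → x'.vtx = y'.vtx →
        ∃ x₁ y₁, Meet p x₁ y₁ ∧ s(arc p x₁, arc p y₁) = s(arc p x, arc p y) := by
      intro x' y' ex ey hv
      have e1 : arc p x' = arc p x := by rcases ex with rfl | rfl; rfl; exact arc_apply hp x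
      have e2 : arc p y' = arc p y := by rcases ey with rfl | rfl; rfl; exact arc_apply hp y
      refine ⟨x', y', ?_, by rw [e1, e2]⟩
      have h1 := pos_facts hp x y
      have hx' := mem_openers.1 hx
      have hy' := mem_openers.1 hy
      have hne' : x.pos ≠ y.pos := fun h => hne (eq_iff.2 h)
      refine ⟨?_, ?_, hv⟩ <;> rw [Ne, eq_iff] <;> rcases ex with rfl | rfl <;>
        rcases ey with rfl | rfl <;> try simp only [hp.1]
      all_goals omega
    rw [arc_of_mem_openers hx, arc_of_mem_openers hy] at h2
    rcases h2 with h | h | h | h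
    · exact key _ _ (Or.inl rfl) (Or.inl rfl) h
    · exact key _ _ (Or.inr rfl) (Or.inr rfl) h
    · exact key _ _ (Or.inr rfl) (Or.inl rfl) h
    · exact key _ _ (Or.inl rfl) (Or.inr rfl) h.symm

/-- Each pair in the symmetric difference meets at some vertex, and the exchange there removes this
pair and changes nothing else. -/
lemma exists_crossed_eq {G : TangledDiagram n} {p : HalfEdge d → HalfEdge d}
    (hp : IsFPFInvolution p) (h : arcs p = G.arcs) :
    ∃ q : HalfEdge d → HalfEdge d, IsFPFInvolution q ∧ arcs q = G.arcs ∧ crossed q = G.crossed := by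
  obtain ⟨N, hN⟩ : ∃ N, (symmDiff (crossed p) G.crossed).card = N := ⟨_, rfl⟩
  induction N generalizing p with
  | zero =>
    exact ⟨p, hp, h, by rwa [Finset.card_eq_zero, ← Finset.bot_eq_empty, symmDiff_eq_bot] at hN⟩
  | succ N ih =>
    obtain ⟨z, hz⟩ : (symmDiff (crossed p) G.crossed).Nonempty := by
      rw [← Finset.card_pos]; omega
    have hz' : z ∈ crossed p ∨ z ∈ G.crossed := by
      rcases Finset.mem_symmDiff.1 hz with h | h
      · exact Or.inl h.1
      · exact Or.inr h.1
    obtain ⟨x, y, hm, rfl⟩ := exists_meet hp h hz'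
    refine ih (IsFPFInvolution.swapAt hp x y) ((arcs_swapAt hp hm).trans h) ?_
    rw [crossed_swapAt hp hm, symmDiff_right_comm, symmDiff_comm,
      symmDiff_of_le (Finset.singleton_subset_iff.2 hz), Finset.card_sdiff_of_subset
      (Finset.singleton_subset_iff.2 hz), hN, Finset.card_singleton]
    rfl

/-- Splitting the vertices of degree two turns the tangled-diagrams with degrees `d` into the
perfect matchings of their half-edges. -/
theorem card_tangledDiagram_degree (hd : ∀ v, d v ≤ 2) (k : ℕ) :
    Nat.card {G : TangledDiagram n // G.IsNoncrossing k ∧ ∀ v, G.degree v = d v} =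
      Nat.card (NoncrossingInvolution k (HalfEdge d)) := by
  symm
  refine Nat.card_congr (Equiv.ofBijective (fun p => ⟨toTangledDiagram p.2.1 hd,
    (isNoncrossing_iff p.2.1 hd k).2 p.2.2, degree_arcs p.2.1 hd⟩) ⟨?_, ?_⟩)
  · intro p q h
    have h' := congrArg Subtype.val h
    exact Subtype.ext (arcs_crossed_injective p.2.1 q.2.1
      (congrArg TangledDiagram.arcs h') (congrArg TangledDiagram.crossed h'))
  · rintro ⟨G, hk, hG⟩
    obtain ⟨p, hp, h⟩ := exists_arcs_eq G hd hG
    obtain ⟨q, hq, h1, h2⟩ := exists_crossed_eq hp h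
    have e : toTangledDiagram hq hd = G := TangledDiagram.ext h1 h2
    refine ⟨⟨q, hq, (isNoncrossing_iff hq hd k).1 (e ▸ hk)⟩, Subtype.ext e⟩

theorem card_tangledDiagram_degree_eq (hd : ∀ v, d v ≤ 2) (k : ℕ) :
    Nat.card {G : TangledDiagram n // G.IsNoncrossing k ∧ ∀ v, G.degree v = d v} =
      Nat.card (NoncrossingInvolution k (Fin (∑ v, d v))) := by
  rw [card_tangledDiagram_degree hd, card_noncrossingInvolution_congr
    (Fintype.orderIsoFinOfCardEq (HalfEdge d) (card_eq hd))]

end HalfEdge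

/-! ### The binomial sum. -/

theorem numMatchings_eq (k m : ℕ) :
    numMatchings k m = Nat.card (NoncrossingInvolution k (Fin m)) := by
  have := HalfEdge.card_tangledDiagram_degree_eq (n := m) (d := fun _ => 1) (fun _ => by omega) k
  have e : ∑ _v : Fin m, 1 = m := by simp
  rwa [e] at this

/-- The diagrams are sorted by their set `s` of vertices of degree one. All other degrees are two,
so there are `2 * n - s.card` half-edges. -/
theorem numTangledNoIsolated_eq (k n : ℕ) : numTangledNoIsolated k n =
    ∑ l ∈ Finset.range (n + 1), n.choose l * numMatchings k (2 * n - l) := by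
  have h1 : ∀ s : Finset (Fin n),
      Nat.card {G : TangledDiagram n // G.IsNoncrossing k ∧
        ∀ v, G.degree v = if v ∈ s then 1 else 2} = numMatchings k (2 * n - s.card) := by
    intro s
    rw [HalfEdge.card_tangledDiagram_degree_eq (fun v => by split_ifs <;> omega), numMatchings_eq]
    have h2 : ∑ v, (if v ∈ s then 1 else 2) + s.card = 2 * n := by
      have : s.card = ∑ v, if v ∈ s then 1 else 0 := by simp
      rw [this, ← Finset.sum_add_distrib]
      have : ∀ v, ((if v ∈ s then 1 else 2) + if v ∈ s then 1 else 0) = 2 := by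
        intro v; split_ifs <;> rfl
      simp [this, mul_comm]
    rw [← h2, Nat.add_sub_cancel]
  have h2 := Finset.sum_powerset_apply_card (fun l => numMatchings k (2 * n - l))
    (x := (Finset.univ : Finset (Fin n)))
  simp only [Finset.card_univ, Fintype.card_fin, smul_eq_mul] at h2
  rw [← h2, Finset.powerset_univ, ← Finset.sum_congr rfl fun s _ => h1 s, ← Nat.card_sigma]
  refine Nat.card_congr
    { toFun := fun G => ⟨Finset.univ.filter fun v => G.1.degree v = 1, G.1, G.2.1, fun v => ?_⟩
      invFun := fun G => ⟨G.2.1, G.2.2.1, fun v => ?_⟩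
      left_inv := fun G => rfl
      right_inv := ?_ }
  · have h3 := G.2.2 v
    have h4 : G.1.degree v ≤ 2 := G.1.degree_le_two v
    simp only [Finset.mem_filter, Finset.mem_univ, true_and]
    split_ifs <;> omega
  · rw [G.2.2.2 v]; split_ifs <;> omega
  · rintro ⟨s, G, hG⟩
    have : (Finset.univ.filter fun v => G.degree v = 1) = s := by
      ext v
      simp only [Finset.mem_filter, Finset.mem_univ, true_and, hG.2 v]
      split_ifs with h <;> simp [h]
    subst this
    rfl

/-!
### Two-row standard Young tableaux as words

A word of booleans encodes the standard Young tableau with at most two rows whose `i`-th smallest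
entry lies in the first row if the `i`-th letter is `false`, and in the second row otherwise.
-/

namespace TableauWord

/-- Schensted insertion of a new entry which becomes the `q`-th smallest one (counting from `0`),
for the reversed order on the entries. -/
def ins : ℕ → List Bool → List Bool
  | 0, w => false :: w
  | _ + 1, [] => [false]
  | q + 1, a :: w =>
    if q ≠ 0 ∧ a = false ∧ w.head? = some false then false :: ins q w else true :: ins q w

/-- Insertion at a position beyond `lim w` would create a third row. -/
def lim : List Bool → ℕ
  | [] => 0
  | false :: w => lim w + 1
  | true :: w => w.idxOf false + 1

/-- Every suffix of the word contains at least as many `false` as `true`. -/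
def IsBallot : List Bool → Prop
  | [] => True
  | a :: w => IsBallot w ∧ (a = true → w.count true < w.count false)

/-- The inverse of the insertions that create an entry in the second row. -/
def unbump : List Bool → List Bool
  | [] => []
  | false :: w => false :: unbump w
  | true :: w => false :: w.erase false

@[simp] lemma ins_zero (w : List Bool) : ins 0 w = false :: w := by cases w <;> rfl

@[simp] lemma ins_succ_true (q : ℕ) (w : List Bool) : ins (q + 1) (true :: w) = true :: ins q w := by
  simp [ins]

@[simp] lemma ins_one_cons (a : Bool) (w : List Bool) : ins 1 (a :: w) = true :: false :: w := by
  simp [ins]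

lemma ins_false_false (q : ℕ) (w : List Bool) :
    ins (q + 2) (false :: false :: w) = false :: ins (q + 1) (false :: w) := by
  simp [ins]

lemma ins_false_true (q : ℕ) (w : List Bool) :
    ins (q + 1) (false :: true :: w) = true :: ins q (true :: w) := by
  simp [ins]

lemma lim_le_length (w : List Bool) : lim w ≤ w.length := by
  induction w with
  | nil => simp [lim]
  | cons a w ih =>
    cases a
    · simpa [lim] using ih
    · simpa [lim] using List.idxOf_le_length

lemma idxOf_le_lim (w : List Bool) : w.idxOf false ≤ lim w := by
  rcases w with _ | ⟨a, w⟩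
  · simp [lim]
  · cases a
    · simp
    · rw [lim, List.idxOf_cons_ne _ (by simp)]

lemma tail_ins (q : ℕ) (a : Bool) (w : List Bool) : (ins (q + 1) (a :: w)).tail = ins q w := by
  rw [ins]; split_ifs <;> rfl

lemma length_ins {q : ℕ} {w : List Bool} (h : q ≤ w.length) : (ins q w).length = w.length + 1 := by
  induction w generalizing q with
  | nil =>
    obtain rfl : q = 0 := by simpa using h
    simp
  | cons a w ih =>
    cases q with
    | zero => simp
    | succ q =>
      have := ih (q := q) (by simpa using h)
      rw [ins]; split_ifs <;> simp [this]

lemma drop_ins_of_le {s q : ℕ} {w : List Bool} (hs : s ≤ q) (hq : q ≤ w.length) :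
    (ins q w).drop s = ins (q - s) (w.drop s) := by
  induction s generalizing q w with
  | zero => simp
  | succ s ih =>
    obtain ⟨q, rfl⟩ : ∃ q', q = q' + 1 := ⟨q - 1, by omega⟩
    cases w with
    | nil => simp at hq
    | cons a w =>
      rw [← List.drop_tail, tail_ins, ih (by omega) (by simpa using hq)]
      simp

lemma drop_ins_of_lt {s q : ℕ} {w : List Bool} (hs : q ≤ s) (hq : q ≤ w.length) :
    (ins q w).drop (s + 1) = w.drop s := by
  have h1 : (ins q w).drop (s + 1) = ((ins q w).drop q).drop (s + 1 - q) := by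
    rw [List.drop_drop]; congr 1; omega
  rw [h1, drop_ins_of_le le_rfl hq, Nat.sub_self, ins_zero, show s + 1 - q = (s - q) + 1 by omega,
    List.drop_succ_cons, List.drop_drop]
  congr 1; omega

lemma idxOf_ins {q : ℕ} {w : List Bool} (h : q ≤ w.idxOf false) :
    (ins q w).idxOf false = q := by
  induction w generalizing q with
  | nil =>
    obtain rfl : q = 0 := by simpa using h
    simp
  | cons a w ih =>
    cases q with
    | zero => simp
    | succ q =>
      cases a
      · simp at h
      · rw [List.idxOf_cons_ne _ (by simp)] at h
        rw [ins_succ_true, List.idxOf_cons_ne _ (by simp), ih (by omega)]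

lemma erase_ins {q : ℕ} {w : List Bool} (h : q ≤ w.idxOf false) :
    (ins q w).erase false = w := by
  induction w generalizing q with
  | nil =>
    obtain rfl : q = 0 := by simpa using h
    simp
  | cons a w ih =>
    cases q with
    | zero => simp
    | succ q =>
      cases a
      · simp at h
      · rw [List.idxOf_cons_ne _ (by simp)] at h
        rw [ins_succ_true, List.erase_cons_tail (by simp), ih (by omega)]

lemma ins_erase {w : List Bool} (h : false ∈ w) :
    w.idxOf false ≤ (w.erase false).idxOf false ∧ ins (w.idxOf false) (w.erase false) = w := by
  induction w with
  | nil => simp at h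
  | cons a w ih =>
    cases a
    · simp
    · have := ih (by simpa using h)
      rw [List.idxOf_cons_ne _ (by simp), List.erase_cons_tail (by simp),
        List.idxOf_cons_ne _ (by simp), Nat.succ_eq_add_one, ins_succ_true, this.2]
      exact ⟨by omega, rfl⟩

/-- The three kinds of insertions. -/
lemma ins_cases {q : ℕ} {w : List Bool} (h : q ≤ lim w) {P : ℕ → List Bool → Prop}
    (h1 : ∀ q w, q ≤ w.idxOf false → P q w)
    (h2 : ∀ q w, q ≤ w.idxOf false → ins (q + 1) (false :: w) = true :: ins q w →
      P (q + 1) (false :: w))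
    (h3 : ∀ q w, q + 1 ≤ lim w → w.idxOf false = 0 →
      ins (q + 2) (false :: w) = false :: ins (q + 1) w → P (q + 1) w → P (q + 2) (false :: w)) :
    P q w := by
  induction w generalizing q with
  | nil => exact h1 _ _ (by simpa [lim] using h)
  | cons a w ih =>
    cases a
    · rcases q with _ | _ | q
      · exact h1 _ _ (by simp)
      · exact h2 0 w (by simp) (by simp)
      · rcases w with _ | ⟨b, w⟩
        · simp [lim] at h
        · cases b
          · exact h3 q _ (by simpa [lim] using h) (by simp) (ins_false_false q w)
              (ih (by simpa [lim] using h))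
          · refine h2 (q + 1) _ ?_ (ins_false_true _ _)
            rw [List.idxOf_cons_ne _ (by simp)]
            simpa [lim] using h
    · refine h1 _ _ ?_
      rw [List.idxOf_cons_ne _ (by simp)]
      simpa [lim] using h

/-- The new entry becomes the first `false` that follows a `true`: either only `true` precedes it,
or it has just bumped a first-row entry into the second row. -/
lemma lim_ins {q : ℕ} {w : List Bool} (h : q ≤ lim w) (hq : q ≠ 0) : lim (ins q w) = q := by
  revert hq
  refine ins_cases (P := fun q w => q ≠ 0 → lim (ins q w) = q) h ?_ ?_ ?_
  · intro q w h hq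
    rcases q with _ | q
    · exact absurd rfl hq
    rcases w with _ | ⟨a, w⟩
    · simp at h
    cases a
    · simp at h
    rw [List.idxOf_cons_ne _ (by simp)] at h
    rw [ins_succ_true, lim, idxOf_ins (by omega)]
  · intro q w h e _
    rw [e, lim, idxOf_ins h]
  · intro q w _ _ e ih _
    rw [e, lim, ih (by omega)]

/-- Schensted insertion can be undone once it is known which row has grown: position and old word
are then functions of the new word. Thus a word has at most two predecessors. -/
lemma unbump_or_erase_ins {q : ℕ} {w : List Bool} (h : q ≤ lim w) :
    (false ∈ ins q w ∧ q = (ins q w).idxOf false ∧ w = (ins q w).erase false) ∨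
      (true ∈ ins q w ∧ q = lim (ins q w) ∧ w = unbump (ins q w)) := by
  refine ins_cases (P := fun q w =>
    (false ∈ ins q w ∧ q = (ins q w).idxOf false ∧ w = (ins q w).erase false) ∨
      (true ∈ ins q w ∧ q = lim (ins q w) ∧ w = unbump (ins q w))) h ?_ ?_ ?_
  · intro q w h
    refine Or.inl ⟨?_, (idxOf_ins h).symm, (erase_ins h).symm⟩
    by_contra hn
    have h2 := idxOf_ins h
    rw [List.idxOf_of_notMem hn, length_ins (h.trans List.idxOf_le_length)] at h2
    have : w.idxOf false ≤ w.length := List.idxOf_le_length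
    omega
  · intro q w h e
    rw [e]
    exact Or.inr ⟨by simp, by rw [lim, idxOf_ins h], by rw [unbump, erase_ins h]⟩
  · intro q w h0 h e ih
    rw [e]
    rcases ih with ih | ih
    -- A first-row extension needs only `true` in front of the new entry, but `w` begins with
    -- `false`.
    · exfalso
      have h1 := lim_ins h0 (by omega)
      rcases w with _ | ⟨a, w⟩
      · simp [lim] at h0
      · cases a
        · have := ih.2.1
          rcases q with _ | q
          · simp at ih
          · have h2 := ih.2.2
            rw [ins] at this
            split_ifs at this with h3
            · simp at this
            · rw [ins, if_neg h3] at h2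
              rw [List.erase_cons_tail (by simp)] at h2
              simp at h2
        · rw [List.idxOf_cons_ne _ (by simp)] at h
          omega
    · exact Or.inr ⟨by simp [ih.1], by rw [lim, ← ih.2.1], by rw [unbump, ← ih.2.2]⟩

lemma IsBallot.count_le {w : List Bool} (h : IsBallot w) : w.count true ≤ w.count false := by
  induction w with
  | nil => simp
  | cons a w ih =>
    have := ih h.1
    cases a
    · simp; omega
    · have := h.2 rfl
      simp; omega

lemma IsBallot.ins_of_le_idxOf {q : ℕ} {w : List Bool} (h : IsBallot w)
    (hq : q ≤ w.idxOf false) : IsBallot (ins q w) ∧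
      (ins q w).count true = w.count true ∧ (ins q w).count false = w.count false + 1 := by
  induction w generalizing q with
  | nil =>
    obtain rfl : q = 0 := by simpa using hq
    simp [IsBallot]
  | cons a w ih =>
    cases q with
    | zero => simpa [IsBallot] using h
    | succ q =>
      cases a
      · simp at hq
      · rw [List.idxOf_cons_ne _ (by simp)] at hq
        obtain ⟨h1, h2, h3⟩ := ih h.1 (q := q) (by omega)
        have := h.2 rfl
        rw [ins_succ_true]
        exact ⟨⟨h1, fun _ => by omega⟩, by simp [h2], by simp [h3]⟩

lemma IsBallot.ins {q : ℕ} {w : List Bool} (h : IsBallot w) (hq : q ≤ lim w) :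
    IsBallot (ins q w) := by
  revert h
  refine ins_cases (P := fun q w => IsBallot w → IsBallot (TableauWord.ins q w)) hq ?_ ?_ ?_
  · exact fun q w hq h => (h.ins_of_le_idxOf hq).1
  · intro q w hq e h
    obtain ⟨h1, h2, h3⟩ := h.1.ins_of_le_idxOf hq
    rw [e]
    exact ⟨h1, fun _ => by have := h.1.count_le; omega⟩
  · intro q w _ _ e ih h
    rw [e]
    exact ⟨ih h.1, by simp⟩

/-- Only `true` precedes the first `false`, so among the suffixes affected by its removal the whole
word is the critical one. -/
lemma isBallot_erase {w : List Bool} (h : IsBallot w) (hw : false ∈ w) :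
    IsBallot (w.erase false) ↔ w.count true < w.count false := by
  have h1 : (w.erase false).count true = w.count true := List.count_erase_of_ne (by simp)
  have h2 : (w.erase false).count false = w.count false - 1 := List.count_erase_self
  have h3 : 0 < w.count false := List.count_pos_iff.2 hw
  constructor
  · intro h'
    have := h'.count_le
    omega
  · intro hlt
    clear h1 h2 h3
    induction w with
    | nil => simp at hw
    | cons a w ih =>
      cases a
      · simpa using h.1
      · have h4 := h.2 rfl
        have hw' : false ∈ w := by simpa using hw
        rw [List.erase_cons_tail (by simp)]
        refine ⟨ih h.1 hw' h4, fun _ => ?_⟩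
        have h1 : (w.erase false).count true = w.count true := List.count_erase_of_ne (by simp)
        have h2 : (w.erase false).count false = w.count false - 1 := List.count_erase_self
        simp at hlt
        omega

/-- Shortening the second row always leaves a legal shape, so no strict inequality is needed, in
contrast to `isBallot_erase`. -/
lemma IsBallot.unbump {w : List Bool} (h : IsBallot w) (hw : true ∈ w) :
    IsBallot (unbump w) ∧ (unbump w).count true + 1 = w.count true ∧
      (unbump w).count false = w.count false ∧ lim w ≤ lim (unbump w) ∧
        TableauWord.ins (lim w) (TableauWord.unbump w) = w := by
  induction w with
  | nil => simp at hw
  | cons a w ih =>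
    cases a
    · obtain ⟨h1, h2, h3, h4, h5⟩ := ih h.1 (by simpa using hw)
      refine ⟨⟨h1, by simp⟩, by simpa [TableauWord.unbump] using h2,
        by simpa [TableauWord.unbump] using h3, by simpa [lim, TableauWord.unbump] using h4, ?_⟩
      rw [lim, TableauWord.unbump]
      rcases w with _ | ⟨b, w⟩
      · simp at hw
      · cases b
        · have : lim (false :: w) ≠ 0 := by simp [lim]
          obtain ⟨l, hl⟩ := Nat.exists_eq_succ_of_ne_zero this
          rw [TableauWord.unbump] at h5 ⊢
          rw [hl] at h5 ⊢
          rw [Nat.succ_eq_add_one, ins_false_false, h5]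
        · rw [TableauWord.unbump] at h5 ⊢
          rw [lim] at h5 ⊢
          rw [ins_false_false, h5]
    · have h4 := h.2 rfl
      have hm : false ∈ w := List.count_pos_iff.1 (by omega)
      have h1 : (w.erase false).count true = w.count true := List.count_erase_of_ne (by simp)
      have h2 : (w.erase false).count false = w.count false - 1 := List.count_erase_self
      have h5 := ins_erase hm
      have hb := (isBallot_erase h.1 hm).2 h4
      refine ⟨⟨hb, by simp⟩, by simp [TableauWord.unbump, h1], ?_, ?_, ?_⟩
      · simp [TableauWord.unbump, h2]; omega
      · rw [TableauWord.unbump, lim, lim]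
        have := idxOf_le_lim (w.erase false)
        omega
      · rw [TableauWord.unbump, lim, TableauWord.ins]
        rw [if_neg, h5.2]
        rintro ⟨h6, _, h7⟩
        rcases hv : w.erase false with _ | ⟨b, v⟩
        · simp [hv] at h7
        · simp only [hv, List.head?_cons, Option.some.injEq] at h7
          subst h7
          rw [hv] at h5
          simp at h5
          omega

end TableauWord

/-!
### Matchings and their tableaux

A partial matching of the points `0, …, t - 1` with `r` open arcs is described by the matching of
`0, …, t + r - 1` in which the last `r` points are the endpoints of the open arcs.
-/

namespace PartialMatching

open TableauWord

/-- Involutions matching the points below `t + r`, the last `r` of them with points below `t`. -/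
def IsPartial (t r : ℕ) (p : ℕ → ℕ) : Prop :=
  (∀ x, p (p x) = x) ∧ (∀ x, p x = x ↔ t + r ≤ x) ∧ ∀ x, t ≤ x → x < t + r → p x < t

/-- There are no three mutually crossing arcs. -/
def NoThreeCrossing (p : ℕ → ℕ) : Prop :=
  ∀ a b c, a < b → b < c → c < p a → p a < p b → p b < p c → False

/-- Two crossing arcs have their right endpoints in `[lo, hi)`. -/
def HasCrossing (p : ℕ → ℕ) (lo hi : ℕ) : Prop :=
  ∃ a b, a < b ∧ lo ≤ p a ∧ p a < p b ∧ p b < hi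

/-- The increasing map that skips `t` and `j`. -/
def skip (t j x : ℕ) : ℕ := if x < t then x else if x + 1 < j then x + 1 else x + 2

/-- The inverse of `skip`. -/
def unskip (t j y : ℕ) : ℕ := if y ≤ t then y else if y ≤ j then y - 1 else y - 2

/-- Remove the arc `(t, j)`. -/
def removeArc (t j : ℕ) (p : ℕ → ℕ) (x : ℕ) : ℕ := unskip t j (p (skip t j x))

/-- Add the arc `(t, j)`. -/
def addArc (t j : ℕ) (p : ℕ → ℕ) (y : ℕ) : ℕ :=
  if y = t then j else if y = j then t else skip t j (p (unskip t j y))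

/-- The tableau on the open arcs. -/
def word : ℕ → (ℕ → ℕ) → List Bool
  | 0, _ => []
  | t + 1, p =>
    if p t < t then (word t p).tail else ins (p t - (t + 1)) (word t (removeArc t (p t) p))

lemma unskip_skip {t j : ℕ} (x : ℕ) : unskip t j (skip t j x) = x := by
  unfold skip unskip; split_ifs <;> omega

lemma skip_unskip {t j y : ℕ} (h : t < j) (h1 : y ≠ t) (h2 : y ≠ j) :
    skip t j (unskip t j y) = y := by
  unfold skip unskip; split_ifs <;> omega

lemma skip_ne {t j : ℕ} (h : t < j) (x : ℕ) : skip t j x ≠ t ∧ skip t j x ≠ j := by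
  unfold skip; split_ifs <;> omega

lemma skip_lt_skip {t j x y : ℕ} : skip t j x < skip t j y ↔ x < y := by
  unfold skip; split_ifs <;> omega

lemma exists_skip {t j y : ℕ} (h : t < j) (h1 : y ≠ t) (h2 : y ≠ j) : ∃ x, y = skip t j x :=
  ⟨_, (skip_unskip h h1 h2).symm⟩

lemma addArc_skip {t j : ℕ} (h : t < j) (p : ℕ → ℕ) (x : ℕ) :
    addArc t j p (skip t j x) = skip t j (p x) := by
  have := skip_ne h x
  rw [addArc, if_neg this.1, if_neg this.2, unskip_skip]

lemma addArc_left (t j : ℕ) (p : ℕ → ℕ) : addArc t j p t = j := by simp [addArc]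

lemma addArc_right {t j : ℕ} (h : t < j) (p : ℕ → ℕ) : addArc t j p j = t := by
  simp [addArc, h.ne']

lemma removeArc_addArc {t j : ℕ} (h : t < j) (p : ℕ → ℕ) : removeArc t j (addArc t j p) = p := by
  funext x
  rw [removeArc, addArc_skip h, unskip_skip]

lemma addArc_removeArc {t j : ℕ} (h : t < j) {p : ℕ → ℕ} (hp : ∀ x, p (p x) = x) (hj : p t = j) :
    addArc t j (removeArc t j p) = p := by
  funext y
  by_cases h1 : y = t
  · rw [h1, addArc_left, hj]
  by_cases h2 : y = j
  · rw [h2, addArc_right h, ← hj, hp]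
  obtain ⟨x, rfl⟩ := exists_skip h h1 h2
  rw [addArc_skip h, removeArc, skip_unskip h]
  · intro h3
    exact h2 ((hp _).symm.trans ((congrArg p h3).trans hj))
  · intro h3
    exact h1 ((hp _).symm.trans ((congrArg p (h3.trans hj.symm)).trans (hp t)))

lemma IsPartial.addArc {t r q : ℕ} {p : ℕ → ℕ} (h : IsPartial t r p) (hq : q ≤ r) :
    IsPartial (t + 1) (r + 1) (addArc t (t + 1 + q) p) := by
  have hlt : t < t + 1 + q := by omega
  obtain ⟨h1, h2, h3⟩ := h
  have key : ∀ x, x = t ∨ x = t + 1 + q ∨ ∃ y, x = skip t (t + 1 + q) y := by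
    intro x
    by_cases e1 : x = t
    · exact Or.inl e1
    by_cases e2 : x = t + 1 + q
    · exact Or.inr (Or.inl e2)
    exact Or.inr (Or.inr (exists_skip hlt e1 e2))
  refine ⟨?_, ?_, ?_⟩
  · intro x
    rcases key x with rfl | rfl | ⟨y, rfl⟩
    · rw [addArc_left, addArc_right hlt]
    · rw [addArc_right hlt, addArc_left]
    · rw [addArc_skip hlt, addArc_skip hlt, h1]
  · intro x
    rcases key x with rfl | rfl | ⟨y, rfl⟩
    · rw [addArc_left]; omega
    · rw [addArc_right hlt]; omega
    · rw [addArc_skip hlt]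
      have e1 : skip t (t + 1 + q) (p y) = skip t (t + 1 + q) y ↔ p y = y :=
        ⟨fun e => by rw [← unskip_skip (p y), e, unskip_skip], fun e => by rw [e]⟩
      rw [e1, h2]
      unfold skip
      split_ifs <;> omega
  · intro x hx hx'
    rcases key x with rfl | rfl | ⟨y, rfl⟩
    · omega
    · rw [addArc_right hlt]; omega
    · rw [addArc_skip hlt]
      have := h3 y
      unfold skip at hx hx' ⊢
      split_ifs at hx hx' ⊢ <;> omega

lemma IsPartial.removeArc {t r : ℕ} {p : ℕ → ℕ} (h : IsPartial (t + 1) r p) (ht : ¬ p t < t) :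
    ∃ q r', r = r' + 1 ∧ q ≤ r' ∧ p t = t + 1 + q ∧ IsPartial t r' (removeArc t (p t) p) := by
  obtain ⟨h1, h2, h3⟩ := h
  have ht1 : p t ≠ t := fun e => by have := (h2 t).1 e; omega
  have ht2 : p t < t + 1 + r := by
    by_contra hge
    have := (h2 (p t)).2 (by omega)
    rw [h1] at this
    omega
  obtain ⟨q, hq⟩ : ∃ q, p t = t + 1 + q := ⟨p t - (t + 1), by omega⟩
  have hlt : t < p t := by omega
  refine ⟨q, r - 1, by omega, by omega, hq, ?_⟩
  obtain ⟨p', hp'⟩ : ∃ p', p' = PartialMatching.removeArc t (p t) p := ⟨_, rfl⟩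
  obtain ⟨j, hj⟩ : ∃ j, p t = j := ⟨_, rfl⟩
  have e : p = PartialMatching.addArc t j p' := by
    rw [hp', hj, addArc_removeArc (by omega) h1 hj]
  rw [← hp']
  rw [hj] at hq hlt
  have hs : ∀ x, p (skip t j x) = skip t j (p' x) := fun x => by
    rw [e]; exact addArc_skip hlt p' x
  have hinj : ∀ x y, skip t j x = skip t j y → x = y := fun x y e => by
    rw [← unskip_skip x, e, unskip_skip]
  refine ⟨?_, ?_, ?_⟩
  · intro x
    apply hinj
    rw [← hs, ← hs, h1]
  · intro x
    have h4 := h2 (skip t j x)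
    rw [hs] at h4
    have h5 : p' x = x ↔ skip t j (p' x) = skip t j x := ⟨fun e => by rw [e], hinj _ _⟩
    rw [h5, h4]
    unfold skip
    split_ifs <;> omega
  · intro x hx hx'
    have h4 := h3 (skip t j x)
    rw [hs] at h4
    unfold skip at h4
    split_ifs at h4 <;> omega

/-- Closing an arc leaves `p` itself unchanged: `t` is reinterpreted, from the first endpoint of an
open arc to an ordinary matched point. -/
lemma IsPartial.succ_iff {t r : ℕ} {p : ℕ → ℕ} :
    (IsPartial (t + 1) r p ∧ p t < t) ↔ IsPartial t (r + 1) p := by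
  constructor
  · rintro ⟨⟨h1, h2, h3⟩, ht⟩
    refine ⟨h1, fun x => by rw [h2]; omega, fun x hx hx' => ?_⟩
    rcases hx.eq_or_lt with rfl | hx
    · exact ht
    · have h4 := h3 x hx (by omega)
      have : p x ≠ t := fun e => by rw [← e, h1] at ht; omega
      omega
  · rintro ⟨h1, h2, h3⟩
    exact ⟨⟨h1, fun x => by rw [h2]; omega, fun x hx hx' =>
      (h3 x (by omega) (by omega)).trans (by omega)⟩, h3 t le_rfl (by omega)⟩

lemma IsPartial.lt_of_mem {t r : ℕ} {p : ℕ → ℕ} (h : IsPartial t r p) {a : ℕ} (h1 : t ≤ p a)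
    (h2 : p a < t + r) : a < t := by
  have := h.2.2 (p a) h1 h2
  rwa [h.1] at this

/-- The new arc starts to the right of all other left endpoints, so in a crossing triple it can only
be the last one. The other two are then crossing open arcs that end before it. -/
lemma noThreeCrossing_addArc {t r q : ℕ} {p : ℕ → ℕ} (h : IsPartial t r p) (hq : q ≤ r) :
    NoThreeCrossing (addArc t (t + 1 + q) p) ↔
      NoThreeCrossing p ∧ ¬ HasCrossing p t (t + q) := by
  have hlt : t < t + 1 + q := by omega
  constructor
  · intro hn
    refine ⟨fun a b c h1 h2 h3 h4 h5 => hn (skip t (t + 1 + q) a) (skip t (t + 1 + q) b)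
      (skip t (t + 1 + q) c) ?_ ?_ ?_ ?_ ?_, ?_⟩
    · rwa [skip_lt_skip]
    · rwa [skip_lt_skip]
    · rwa [addArc_skip hlt, skip_lt_skip]
    · rwa [addArc_skip hlt, addArc_skip hlt, skip_lt_skip]
    · rwa [addArc_skip hlt, addArc_skip hlt, skip_lt_skip]
    · rintro ⟨a, b, h1, h2, h3, h4⟩
      have hb : b < t := h.lt_of_mem (by omega) (by omega)
      have sa : skip t (t + 1 + q) a = a := by unfold skip; split_ifs <;> omega
      have sb : skip t (t + 1 + q) b = b := by unfold skip; split_ifs; omega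
      have ea := addArc_skip hlt p a
      have eb := addArc_skip hlt p b
      have sa' : skip t (t + 1 + q) (p a) = p a + 1 := by unfold skip; split_ifs <;> omega
      have sb' : skip t (t + 1 + q) (p b) = p b + 1 := by unfold skip; split_ifs <;> omega
      rw [sa, sa'] at ea
      rw [sb, sb'] at eb
      refine hn a b t h1 hb ?_ ?_ ?_
      · omega
      · omega
      · rw [addArc_left]; omega
  · rintro ⟨hn, hc⟩ a b c h1 h2 h3 h4 h5
    have hP := h.addArc hq
    have ha : c ≤ t := by
      by_contra hct
      have h6 := hP.2.2 c (by omega)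
      have h7 := hP.2.1 c
      by_cases h8 : c < t + 1 + (r + 1)
      · have := h6 h8; omega
      · rw [h7.2 (by omega)] at h5; omega
    have nt : ∀ x, x < t → ∃ y, x = skip t (t + 1 + q) y ∧ x = y := fun x hx =>
      ⟨x, by unfold skip; split_ifs; omega, rfl⟩
    obtain ⟨a', ha', rfl⟩ := nt a (by omega)
    obtain ⟨b', hb', rfl⟩ := nt b (by omega)
    have ea := addArc_skip hlt p a
    have eb := addArc_skip hlt p b
    rw [← ha'] at ea
    rw [← hb'] at eb
    rcases ha.eq_or_lt with rfl | hct
    · rw [addArc_left] at h5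
      rw [ea, eb, skip_lt_skip] at h4
      rw [ea] at h3
      rw [eb] at h5
      refine hc ⟨a, b, h1, ?_, h4, ?_⟩
      · unfold skip at h3; split_ifs at h3 <;> omega
      · unfold skip at h5; split_ifs at h5 <;> omega
    · obtain ⟨c', hc', rfl⟩ := nt c hct
      have ec := addArc_skip hlt p c
      rw [← hc'] at ec
      rw [ea, eb, skip_lt_skip] at h4
      rw [eb, ec, skip_lt_skip] at h5
      rw [hc', ea, skip_lt_skip] at h3
      exact hn a b c h1 h2 h3 h4 h5

end PartialMatching

/-! ### The tableau of the open arcs controls their crossings. -/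

namespace PartialMatching

open TableauWord

lemma exists_eq_skip {t j y : ℕ} (h : y < t) : y = skip t j y := by
  unfold skip; split_ifs; rfl

/-- Where crossings among the open arcs occur after adding the arc `(t, t + 1 + q₀)`. -/
lemma hasCrossing_addArc {t r q₀ s q : ℕ} {p : ℕ → ℕ} (h : IsPartial t r p) (hq₀ : q₀ ≤ r)
    (hq : q ≤ r + 1) (hc : ¬ HasCrossing p t (t + q₀)) :
    HasCrossing (addArc t (t + 1 + q₀) p) (t + 1 + s) (t + 1 + q) ↔
      if s < q₀ then q₀ < q else if s = q₀ then HasCrossing p (t + s) (t + (q - 1))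
        else HasCrossing p (t + (s - 1)) (t + (q - 1)) := by
  have hlt : t < t + 1 + q₀ := by omega
  have hP := h.addArc hq₀
  have ha : ∀ a, a < t → addArc t (t + 1 + q₀) p a = skip t (t + 1 + q₀) (p a) := by
    intro a ha
    conv_lhs => rw [exists_eq_skip (j := t + 1 + q₀) ha]
    exact addArc_skip hlt p a
  have ht : addArc t (t + 1 + q₀) p t = t + 1 + q₀ := addArc_left _ _ _
  have hlt' : ∀ a, t + 1 ≤ addArc t (t + 1 + q₀) p a → addArc t (t + 1 + q₀) p a < t + 1 + q →
      a < t + 1 := fun a h1 h2 => hP.lt_of_mem h1 (by omega)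
  constructor
  · rintro ⟨a, b, h1, h2, h3, h4⟩
    have hb := hlt' b (by omega) h4
    have ea := ha a (by omega)
    rw [ea] at h2 h3
    rcases (Nat.lt_succ_iff.1 hb).eq_or_lt with rfl | hb
    · rw [ht] at h3 h4
      have : s < q₀ := by unfold skip at h2 h3; split_ifs at h2 h3 <;> omega
      rw [if_pos this]
      omega
    · rw [ha b hb] at h3 h4
      rw [skip_lt_skip] at h3
      have hcr : ¬ p b < t + q₀ := by
        intro hlt
        refine hc ⟨a, b, h1, ?_, h3, hlt⟩
        unfold skip at h2
        split_ifs at h2 <;> omega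
      have h4' : p b + 2 < t + 1 + q := by
        unfold skip at h4
        split_ifs at h4 <;> omega
      split_ifs with c1 c2
      · omega
      · refine ⟨a, b, h1, ?_, h3, by omega⟩
        unfold skip at h2
        split_ifs at h2 <;> omega
      · refine ⟨a, b, h1, ?_, h3, by omega⟩
        unfold skip at h2
        split_ifs at h2 <;> omega
  · intro hif
    split_ifs at hif with c1 c2
    -- The old open arc ending at `t + s` starts before `t` and ends before the new arc, hence
    -- crosses it.
    · have hs : p (p (t + s)) = t + s := h.1 _
      have hlt2 := h.2.2 (t + s) (by omega) (by omega)
      have es : skip t (t + 1 + q₀) (t + s) = t + s + 1 := by unfold skip; split_ifs <;> omega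
      refine ⟨p (t + s), t, hlt2, ?_, ?_, ?_⟩
      · rw [ha _ hlt2, hs, es]; omega
      · rw [ha _ hlt2, hs, es, ht]; omega
      · rw [ht]; omega
    · obtain ⟨a, b, h1, h2, h3, h4⟩ := hif
      have hb : b < t := h.lt_of_mem (by omega) (by omega)
      refine ⟨a, b, h1, ?_, ?_, ?_⟩
      · rw [ha a (by omega)]; unfold skip; split_ifs <;> omega
      · rwa [ha a (by omega), ha b hb, skip_lt_skip]
      · rw [ha b hb]; unfold skip; split_ifs <;> omega
    · obtain ⟨a, b, h1, h2, h3, h4⟩ := hif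
      have hb : b < t := h.lt_of_mem (by omega) (by omega)
      refine ⟨a, b, h1, ?_, ?_, ?_⟩
      · rw [ha a (by omega)]; unfold skip; split_ifs <;> omega
      · rwa [ha a (by omega), ha b hb, skip_lt_skip]
      · rw [ha b hb]; unfold skip; split_ifs <;> omega

/-- The word of a partial matching governs the crossings of its open arcs. -/
def Governs (t r : ℕ) (p : ℕ → ℕ) (w : List Bool) : Prop :=
  w.length = r ∧ IsBallot w ∧ ∀ s q, s ≤ q → q ≤ r →
    (HasCrossing p (t + s) (t + q) ↔ s + lim (w.drop s) < q)

lemma Governs.le_lim_iff {t r q : ℕ} {p : ℕ → ℕ} {w : List Bool} (h : Governs t r p w)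
    (hq : q ≤ r) : q ≤ lim w ↔ ¬ HasCrossing p t (t + q) := by
  have := h.2.2 0 q (Nat.zero_le _) hq
  simp only [add_zero, List.drop_zero, zero_add] at this
  rw [this, not_lt]

/-- The three cases of `hasCrossing_addArc` match the suffixes of `ins q₀ w` that start before, at
and after the new entry. Control of all suffixes is what lets the invariant survive closing, which
takes the tail. -/
lemma Governs.addArc {t r q₀ : ℕ} {p : ℕ → ℕ} {w : List Bool} (hp : IsPartial t r p)
    (h : Governs t r p w) (hq₀ : q₀ ≤ lim w) :
    Governs (t + 1) (r + 1) (addArc t (t + 1 + q₀) p) (ins q₀ w) := by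
  obtain ⟨h1, h2, h3⟩ := h
  have hle : q₀ ≤ w.length := hq₀.trans (lim_le_length w)
  have hc := (Governs.le_lim_iff ⟨h1, h2, h3⟩ (h1 ▸ hle)).1 hq₀
  refine ⟨by rw [length_ins hle, h1], h2.ins hq₀, fun s q hs hq => ?_⟩
  rw [hasCrossing_addArc hp (h1 ▸ hle) hq hc]
  split_ifs with c1 c2
  · have h4 : q₀ - s ≤ lim (w.drop s) := by
      have := (h3 s q₀ c1.le (h1 ▸ hle)).not.1 (by
        rintro ⟨a, b, e1, e2, e3, e4⟩
        exact hc ⟨a, b, e1, by omega, e3, e4⟩)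
      omega
    rw [drop_ins_of_le c1.le hle, lim_ins h4 (by omega)]
    omega
  · subst c2
    rw [drop_ins_of_le le_rfl hle, Nat.sub_self, ins_zero, lim]
    rcases hs.eq_or_lt with rfl | hs
    · constructor
      · rintro ⟨a, b, e1, e2, e3, e4⟩; omega
      · omega
    · rw [h3 s (q - 1) (by omega) (by omega)]
      omega
  · obtain ⟨s, rfl⟩ : ∃ s', s = s' + 1 := ⟨s - 1, by omega⟩
    rw [drop_ins_of_lt (by omega) hle, Nat.add_sub_cancel, h3 s (q - 1) (by omega) (by omega)]
    omega

lemma governs_word {t r : ℕ} {p : ℕ → ℕ} (h : IsPartial t r p) (hn : NoThreeCrossing p) :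
    Governs t r p (word t p) := by
  induction t generalizing r p with
  | zero =>
    obtain rfl : r = 0 := by
      by_contra hr
      have := h.2.2 0 le_rfl (by omega)
      omega
    refine ⟨rfl, trivial, fun s q hs hq => ?_⟩
    constructor
    · rintro ⟨a, b, e1, e2, e3, e4⟩; omega
    · omega
  | succ t ih =>
    rw [word]
    split_ifs with ht
    · obtain ⟨h1, h2, h3⟩ := ih (IsPartial.succ_iff.1 ⟨h, ht⟩) hn
      refine ⟨by rw [List.length_tail, h1]; rfl, ?_, fun s q hs hq => ?_⟩
      · rcases hw : word t p with _ | ⟨a, w⟩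
        · trivial
        · rw [hw] at h2; exact h2.1
      · have := h3 (s + 1) (q + 1) (by omega) (by omega)
        rw [List.drop_tail, show t + 1 + s = t + (s + 1) by omega,
          show t + 1 + q = t + (q + 1) by omega, this]
        omega
    · obtain ⟨q, r, rfl, hq, hpt, hP⟩ := h.removeArc ht
      have e : addArc t (t + 1 + q) (removeArc t (p t) p) = p := by
        rw [← hpt]; exact addArc_removeArc (by omega) h.1 rfl
      have hn' := (noThreeCrossing_addArc hP hq).1 (by rwa [e])
      have hg := ih hP hn'.1
      have := hg.addArc hP ((hg.le_lim_iff hq).2 hn'.2)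
      rw [e] at this
      rwa [hpt, Nat.add_sub_cancel_left, ← hpt]

/-- The partial matchings without three mutually crossing arcs and with tableau `w`. -/
def withWord (t : ℕ) (w : List Bool) : Set (ℕ → ℕ) :=
  {p | IsPartial t w.length p ∧ NoThreeCrossing p ∧ word t p = w}

lemma withWord_finite (t : ℕ) (w : List Bool) : (withWord t w).Finite := by
  let N := t + w.length
  have : (Set.range fun f : Fin N → Fin N => fun x : ℕ =>
      if h : x < N then (f ⟨x, h⟩ : ℕ) else x).Finite := Set.finite_range _
  refine this.subset ?_
  rintro p ⟨⟨h1, h2, h3⟩, -, -⟩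
  have hlt : ∀ x, x < N → p x < N := by
    intro x hx
    by_contra hge
    have := (h2 (p x)).2 (by omega)
    rw [h1] at this
    omega
  refine ⟨fun x => ⟨p x, hlt x x.2⟩, ?_⟩
  funext x
  dsimp only
  split_ifs with h
  · rfl
  · exact ((h2 x).2 (by omega)).symm

lemma withWord_eq_empty {t : ℕ} {w : List Bool} (h : ¬ IsBallot w) : withWord t w = ∅ := by
  ext p
  simp only [Set.mem_empty_iff_false, iff_false]
  rintro ⟨h1, h2, rfl⟩
  exact h (governs_word h1 h2).2.1

lemma withWord_zero (w : List Bool) :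
    (withWord 0 w).ncard = if w = [] then 1 else 0 := by
  split_ifs with h
  · subst h
    rw [Set.ncard_eq_one]
    refine ⟨id, ?_⟩
    ext p
    simp only [withWord, Set.mem_ofPred_eq, Set.mem_singleton_iff]
    constructor
    · rintro ⟨⟨_, h, _⟩, -, -⟩
      funext x
      exact (h x).2 (by simp)
    · rintro rfl
      refine ⟨⟨fun _ => rfl, fun x => by simp, fun x _ hx => by simp at hx⟩, ?_, rfl⟩
      intro a b c h1 h2 h3
      simp at h3; omega
  · rw [Set.ncard_eq_zero (withWord_finite _ _)]
    ext p
    simp only [Set.mem_empty_iff_false, iff_false]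
    rintro ⟨_, _, h'⟩
    exact h h'.symm

/-- The partial matchings in which `t` is a left endpoint. -/
lemma addArc_image {t q : ℕ} {w v : List Bool} (hq : q ≤ lim v) (hv : ins q v = w) :
    addArc t (t + 1 + q) '' withWord t v =
      {p ∈ withWord (t + 1) w | p t = t + 1 + q ∧ word t (removeArc t (p t) p) = v} := by
  have hlt : t < t + 1 + q := by omega
  have hlen : q ≤ v.length := hq.trans (lim_le_length v)
  have hw : w.length = v.length + 1 := by rw [← hv, length_ins hlen]
  ext p
  constructor
  · rintro ⟨p, ⟨h1, h2, h3⟩, rfl⟩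
    have hg := governs_word h1 h2
    rw [h3] at hg
    have h4 : word t (removeArc t (addArc t (t + 1 + q) p t) (addArc t (t + 1 + q) p)) = v := by
      rw [addArc_left, removeArc_addArc hlt, h3]
    refine ⟨⟨by rw [hw]; exact h1.addArc hlen,
      (noThreeCrossing_addArc h1 hlen).2 ⟨h2, (hg.le_lim_iff hlen).1 hq⟩, ?_⟩,
      addArc_left _ _ _, h4⟩
    rw [word, if_neg (by rw [addArc_left]; omega), h4, addArc_left, Nat.add_sub_cancel_left, hv]
  · rintro ⟨⟨h1, h2, h3⟩, h4, h5⟩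
    obtain ⟨q', r, hr, hq', hpt, hP⟩ := h1.removeArc (by omega)
    have e : addArc t (t + 1 + q) (removeArc t (p t) p) = p := by
      rw [← h4]; exact addArc_removeArc (by omega) h1.1 rfl
    obtain rfl : r = v.length := by omega
    refine ⟨removeArc t (p t) p, ⟨hP, ?_, h5⟩, e⟩
    rw [← e, noThreeCrossing_addArc hP (by omega)] at h2
    exact h2.1

lemma addArc_injective {t j : ℕ} (h : t < j) : Function.Injective (addArc t j) := fun p q e => by
  rw [← removeArc_addArc h p, e, removeArc_addArc h]

/-- A partial matching with tableau `w` is obtained from a smaller one in at most four ways: by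
closing an open arc, or by adding one that extends the first or the second row. -/
lemma withWord_succ (t : ℕ) {w : List Bool} (hw : IsBallot w) :
    (withWord (t + 1) w).ncard = (withWord t (false :: w)).ncard + (withWord t (true :: w)).ncard +
      ((if false ∈ w then (withWord t (w.erase false)).ncard else 0) +
        if true ∈ w then (withWord t (unbump w)).ncard else 0) := by
  have hcl : {p ∈ withWord (t + 1) w | p t < t} =
      withWord t (false :: w) ∪ withWord t (true :: w) := by
    ext p
    have key : ∀ a, p ∈ withWord t (a :: w) → p ∈ {p ∈ withWord (t + 1) w | p t < t} := by
      rintro a ⟨h1, h2, h3⟩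
      obtain ⟨h1, ht⟩ := IsPartial.succ_iff.2 h1
      exact ⟨⟨h1, h2, by rw [word, if_pos ht, h3]; rfl⟩, ht⟩
    constructor
    · rintro ⟨⟨h1, h2, h3⟩, ht⟩
      have h1' := IsPartial.succ_iff.1 ⟨h1, ht⟩
      rw [word, if_pos ht] at h3
      have hl := (governs_word h1' h2).1
      rcases he : word t p with _ | ⟨a, v⟩
      · rw [he] at hl; simp at hl
      · rw [he] at h3
        obtain rfl : v = w := h3
        cases a
        · exact Or.inl ⟨h1', h2, he⟩
        · exact Or.inr ⟨h1', h2, he⟩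
    · rintro (h | h) <;> exact key _ h
  have hdis : Disjoint (withWord t (false :: w)) (withWord t (true :: w)) := by
    rw [Set.disjoint_left]
    rintro p ⟨_, _, h⟩ ⟨_, _, h'⟩
    simpa using h.symm.trans h'
  let A : Set (ℕ → ℕ) := if false ∈ w then
    addArc t (t + 1 + w.idxOf false) '' withWord t (w.erase false) else ∅
  let B : Set (ℕ → ℕ) := if true ∈ w then
    addArc t (t + 1 + lim w) '' withWord t (unbump w) else ∅
  have hA : A.ncard = if false ∈ w then (withWord t (w.erase false)).ncard else 0 := by
    simp only [A]
    split_ifs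
    · exact Set.ncard_image_of_injective _ (addArc_injective (by omega))
    · exact Set.ncard_empty _
  have hB : B.ncard = if true ∈ w then (withWord t (unbump w)).ncard else 0 := by
    simp only [B]
    split_ifs
    · exact Set.ncard_image_of_injective _ (addArc_injective (by omega))
    · exact Set.ncard_empty _
  have lim_erase : false ∈ w → w.idxOf false ≤ lim (w.erase false) := by
    intro hm
    have := (ins_erase hm).1
    exact this.trans (idxOf_le_lim _)
  have hop : {p ∈ withWord (t + 1) w | ¬ p t < t} = A ∪ B := by
    ext p
    constructor
    · rintro ⟨⟨h1, h2, h3⟩, ht⟩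
      obtain ⟨q, r, hr, hq, hpt, hP⟩ := h1.removeArc ht
      have e : addArc t (t + 1 + q) (removeArc t (p t) p) = p := by
        rw [← hpt]; exact addArc_removeArc (by omega) h1.1 rfl
      have hn := h2
      rw [← e, noThreeCrossing_addArc hP hq] at hn
      have hg := governs_word hP hn.1
      have hlim := (hg.le_lim_iff hq).2 hn.2
      have hw' := h3
      rw [word, if_neg ht, hpt, Nat.add_sub_cancel_left, ← hpt] at hw'
      have hcases := unbump_or_erase_ins hlim
      rw [hw'] at hcases
      rcases hcases with ⟨hm, hq1, hv⟩ | ⟨hm, hq1, hv⟩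
      · left
        simp only [A, if_pos hm]
        rw [← hq1, ← hv, addArc_image hlim hw']
        exact ⟨⟨h1, h2, h3⟩, hpt, rfl⟩
      · right
        simp only [B, if_pos hm]
        rw [← hq1, ← hv, addArc_image hlim hw']
        exact ⟨⟨h1, h2, h3⟩, hpt, rfl⟩
    · rintro (h | h)
      · simp only [A] at h
        split_ifs at h with hm
        · rw [addArc_image (lim_erase hm) (ins_erase hm).2] at h
          exact ⟨h.1, by rw [h.2.1]; omega⟩
        · exact h.elim
      · simp only [B] at h
        split_ifs at h with hm
        · obtain ⟨-, -, -, h4, h5⟩ := hw.unbump hm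
          rw [addArc_image h4 h5] at h
          exact ⟨h.1, by rw [h.2.1]; omega⟩
        · exact h.elim
  -- The two kinds of opening differ in position if `w` begins with `false`, and in the previous
  -- word if it begins with `true`.
  have hdis2 : Disjoint A B := by
    rw [Set.disjoint_left]
    intro p ha hb
    simp only [A] at ha
    simp only [B] at hb
    split_ifs at ha hb with hm1 hm2
    · obtain ⟨-, -, -, h4, h5⟩ := hw.unbump hm2
      rw [addArc_image (lim_erase hm1) (ins_erase hm1).2] at ha
      rw [addArc_image h4 h5] at hb
      have e1 := ha.2.1.symm.trans hb.2.1
      have e2 := ha.2.2.symm.trans hb.2.2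
      rcases w with _ | ⟨a, w⟩
      · simp at hm1
      · cases a
        · simp [lim] at e1
        · rw [unbump, List.erase_cons_tail (by simp)] at e2
          simp at e2
    all_goals first | exact ha.elim | exact hb.elim
  have hfin := withWord_finite (t + 1) w
  have h1 : withWord (t + 1) w =
      {p ∈ withWord (t + 1) w | p t < t} ∪ {p ∈ withWord (t + 1) w | ¬ p t < t} := by
    ext p
    simp only [Set.mem_union, Set.mem_ofPred_eq]
    tauto
  have h2 : Disjoint {p ∈ withWord (t + 1) w | p t < t} {p ∈ withWord (t + 1) w | ¬ p t < t} := by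
    rw [Set.disjoint_left]
    rintro p ⟨_, h⟩ ⟨_, h'⟩
    exact h' h
  have hfin2 : (A ∪ B).Finite := hop ▸ hfin.subset (Set.sep_subset _ _)
  rw [h1, Set.ncard_union_eq h2 (hfin.subset (Set.sep_subset _ _))
    (hfin.subset (Set.sep_subset _ _)), hcl, hop,
    Set.ncard_union_eq hdis (withWord_finite _ _) (withWord_finite _ _),
    Set.ncard_union_eq hdis2 (hfin2.subset Set.subset_union_left)
      (hfin2.subset Set.subset_union_right), hA, hB]

end PartialMatching

/-! ### Counting lattice walks by reflection. -/

namespace LatticeWalk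

/-- The number of walks of length `t` on the integers from `x` to `0`, with steps `±1`. -/
def walks : ℕ → ℤ → ℤ
  | 0, x => if x = 0 then 1 else 0
  | t + 1, x => walks t (x - 1) + walks t (x + 1)

/-- The number of such walks from `x` to `y` that stay nonnegative, by the reflection principle. -/
def nonnegWalks (t : ℕ) (x y : ℤ) : ℤ := walks t (x - y) - walks t (x + y + 2)

/-- The number of pairs of walks of length `t` from `(u, v)` to `(0, 0)` with `u ≥ v ≥ 0`
throughout, as a determinant. -/
def walkPairs (t : ℕ) (u v : ℤ) : ℤ :=
  nonnegWalks t (u + 2) 2 * nonnegWalks t v 0 - nonnegWalks t (u + 2) 0 * nonnegWalks t v 2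

lemma walks_neg (t : ℕ) (x : ℤ) : walks t (-x) = walks t x := by
  induction t generalizing x with
  | zero => simp [walks]
  | succ t ih =>
    rw [walks, walks, ← ih (x - 1), ← ih (x + 1), add_comm]
    congr 2 <;> ring

lemma walks_of_odd {t : ℕ} {x : ℤ} (h : ¬ Even (t + x)) : walks t x = 0 := by
  induction t generalizing x with
  | zero =>
    rw [walks, if_neg]
    rintro rfl
    exact h (by simp)
  | succ t ih =>
    rw [walks, ih, ih, add_zero]
    · rw [Nat.cast_succ] at h; rwa [show (t : ℤ) + (x + 1) = t + 1 + x by ring]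
    · intro h'
      apply h
      have : ((t + 1 : ℕ) : ℤ) + x = t + (x - 1) + 2 := by push_cast; ring
      rw [this]
      exact h'.add even_two

lemma walks_of_lt {t : ℕ} {x : ℤ} (h : (t : ℤ) < x) : walks t x = 0 := by
  induction t generalizing x with
  | zero =>
    rw [walks, if_neg]
    rintro rfl
    simp at h
  | succ t ih =>
    rw [walks, ih (by push_cast at h; omega), ih (by push_cast at h; omega), add_zero]

lemma walks_eq_choose (t j : ℕ) : walks t ((t : ℤ) - 2 * j) = t.choose j := by
  induction t generalizing j with
  | zero =>
    rw [walks]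
    cases j with
    | zero => simp
    | succ j => rw [if_neg (by push_cast; omega)]; simp
  | succ t ih =>
    have e1 : ((t + 1 : ℕ) : ℤ) - 2 * j - 1 = t - 2 * j := by push_cast; ring
    rw [walks, e1, ih]
    cases j with
    | zero => rw [walks_of_lt (by push_cast; omega)]; simp
    | succ j =>
      have e2 : ((t + 1 : ℕ) : ℤ) - 2 * (j + 1 : ℕ) + 1 = t - 2 * j := by push_cast; ring
      rw [e2, ih, Nat.choose_succ_succ]
      push_cast; ring

lemma nonnegWalks_succ (t : ℕ) (x y : ℤ) :
    nonnegWalks (t + 1) x y = nonnegWalks t (x - 1) y + nonnegWalks t (x + 1) y := by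
  simp only [nonnegWalks, walks]
  rw [show x - y - 1 = x - 1 - y by ring, show x - y + 1 = x + 1 - y by ring,
    show x + y + 2 - 1 = x - 1 + y + 2 by ring, show x + y + 2 + 1 = x + 1 + y + 2 by ring]
  ring

lemma nonnegWalks_neg_one (t : ℕ) (y : ℤ) : nonnegWalks t (-1) y = 0 := by
  rw [nonnegWalks, ← walks_neg, show -(-1 - y) = -1 + y + 2 by ring, sub_self]

/-- This wall and the one in `walkPairs_add_two` bound the region `u ≥ v ≥ 0`: as `u - v` stays
even, a walk leaving `u ≥ v` lands on `v = u + 2`. With the recurrence `walkPairs_succ` and the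
initial values they justify the determinant. -/
lemma walkPairs_neg_one (t : ℕ) (u : ℤ) : walkPairs t u (-1) = 0 := by
  rw [walkPairs, nonnegWalks_neg_one, nonnegWalks_neg_one, mul_zero, mul_zero, sub_self]

lemma walkPairs_add_two (t : ℕ) (u : ℤ) : walkPairs t u (u + 2) = 0 := by
  rw [walkPairs]; ring

lemma walkPairs_succ (t : ℕ) (u v : ℤ) : walkPairs (t + 1) u v =
    walkPairs t (u + 1) (v + 1) + walkPairs t (u + 1) (v - 1) +
      (walkPairs t (u - 1) (v - 1) + walkPairs t (u - 1) (v + 1)) := by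
  simp only [walkPairs, nonnegWalks_succ]
  rw [show u + 2 - 1 = u - 1 + 2 by ring, show u + 2 + 1 = u + 1 + 2 by ring]
  ring

lemma walkPairs_zero {u v : ℤ} (hv : 0 ≤ v) (hu : v ≤ u) :
    walkPairs 0 u v = if u = 0 then 1 else 0 := by
  simp only [walkPairs, nonnegWalks, walks]
  by_cases h : u = 0
  · obtain rfl : v = 0 := by omega
    simp [h]
  · rw [if_neg (by omega : ¬ u + 2 - 2 = 0), if_neg (by omega : ¬ u + 2 + 2 + 2 = 0),
      if_neg (by omega : ¬ u + 2 - 0 = 0), if_neg (by omega : ¬ u + 2 + 0 + 2 = 0), if_neg h]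
    simp

lemma catalan_eq (m : ℕ) : (catalan m : ℤ) = walks (2 * m) 0 - walks (2 * m) 2 := by
  have h1 := walks_eq_choose (2 * m) m
  have h2 := walks_eq_choose (2 * m) (m + 1)
  rw [show ((2 * m : ℕ) : ℤ) - 2 * m = 0 by push_cast; ring] at h1
  rw [show ((2 * m : ℕ) : ℤ) - 2 * (m + 1 : ℕ) = -2 by push_cast; ring, walks_neg] at h2
  rw [h1, h2]
  have h3 := succ_mul_catalan_eq_centralBinom m
  have h4 := Nat.choose_succ_right_eq (2 * m) m
  rw [show 2 * m - m = m by omega] at h4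
  rw [Nat.centralBinom_eq_two_mul_choose] at h3
  have h3' : ((m : ℤ) + 1) * catalan m = (2 * m).choose m := by exact_mod_cast h3
  have h4' : ((2 * m).choose (m + 1) : ℤ) * (m + 1) = (2 * m).choose m * m := by exact_mod_cast h4
  have hm : (m : ℤ) + 1 ≠ 0 := by positivity
  apply mul_left_cancel₀ hm
  linear_combination h3' + h4'

/-- Unfolding the two and four extra steps expresses both sides as quadratic polynomials in `walks
(2 * m)` at `0, 2, 4, 6`, and these coincide. -/
lemma walkPairs_two_mul (m : ℕ) : walkPairs (2 * m) 0 0 =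
    (catalan m : ℤ) * catalan (m + 2) - (catalan (m + 1) : ℤ) ^ 2 := by
  have e : ∀ x, walks (2 * (m + 1)) x =
      walks (2 * m) (x - 2) + 2 * walks (2 * m) x + walks (2 * m) (x + 2) := by
    intro x
    rw [show 2 * (m + 1) = 2 * m + 1 + 1 by ring, walks, walks, walks]
    rw [show x - 1 - 1 = x - 2 by ring, show x - 1 + 1 = x by ring, show x + 1 - 1 = x by ring,
      show x + 1 + 1 = x + 2 by ring]
    ring
  have e' : ∀ x, walks (2 * (m + 2)) x = walks (2 * m) (x - 4) + 4 * walks (2 * m) (x - 2) +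
      6 * walks (2 * m) x + 4 * walks (2 * m) (x + 2) + walks (2 * m) (x + 4) := by
    intro x
    rw [show 2 * (m + 2) = 2 * (m + 1) + 1 + 1 by ring, walks, walks, walks, e, e, e, e]
    ring_nf
  have n2 := walks_neg (2 * m) 2
  have n4 := walks_neg (2 * m) 4
  rw [catalan_eq, catalan_eq, catalan_eq, e, e, e', e', walkPairs]
  simp only [nonnegWalks]
  norm_num
  rw [n2, n4]
  ring

lemma walkPairs_odd {t : ℕ} (h : ¬ Even t) : walkPairs t 0 0 = 0 := by
  have h0 : ∀ x : ℤ, Even x → walks t x = 0 := by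
    intro x hx
    apply walks_of_odd
    rw [Int.even_add]
    simp [h, hx]
  simp only [walkPairs, nonnegWalks]
  norm_num
  rw [h0 2 (by decide), h0 4 (by decide), h0 0 (by decide), h0 (-2) (by decide)]
  simp

end LatticeWalk

/-! ### The number of 3-noncrossing matchings. -/

namespace PartialMatching

open TableauWord LatticeWalk

lemma count_add_count (w : List Bool) : w.count false + w.count true = w.length := by
  induction w with
  | nil => rfl
  | cons a w ih => cases a <;> simp <;> omega

/-- The four ways in `withWord_succ` are the four diagonal steps in the sum and difference of the
row lengths, so both sides obey one recurrence. Only the shape of `w` matters. A way that is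
unavailable leads to a wall, where `walkPairs` vanishes. -/
lemma ncard_withWord (t : ℕ) {w : List Bool} (h : IsBallot w) : ((withWord t w).ncard : ℤ) =
    walkPairs t (w.count false + w.count true) (w.count false - w.count true) := by
  induction t generalizing w with
  | zero =>
    have := h.count_le
    rw [withWord_zero, walkPairs_zero (by omega) (by omega)]
    have := count_add_count w
    by_cases hw : w = []
    · simp [hw]
    · have hl : 0 < w.length := List.length_pos_iff.2 hw
      rw [if_neg hw, if_neg (by omega)]
      rfl
  | succ t ih =>
    have hle := h.count_le
    rw [withWord_succ t h, walkPairs_succ]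
    push_cast
    congr 1
    · congr 1
      · rw [ih (w := false :: w) ⟨h, by simp⟩]
        congr 1 <;> simp <;> ring
      · by_cases hlt : w.count true < w.count false
        · rw [ih (w := true :: w) ⟨h, fun _ => hlt⟩]
          congr 1 <;> simp <;> ring
        · rw [withWord_eq_empty (w := true :: w) (fun h' => hlt (h'.2 rfl)), Set.ncard_empty,
            show (w.count false : ℤ) - w.count true - 1 = -1 by omega, walkPairs_neg_one]
          rfl
    · congr 1
      · by_cases hlt : w.count true < w.count false
        · have hm : false ∈ w := List.count_pos_iff.1 (by omega)
          rw [if_pos hm, ih ((isBallot_erase h hm).2 hlt),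
            List.count_erase_of_ne (a := true) (b := false) (by simp), List.count_erase_self, Nat.cast_sub (by omega)]
          congr 1 <;> push_cast <;> ring
        · rw [show (w.count false : ℤ) - w.count true - 1 = -1 by omega, walkPairs_neg_one]
          split_ifs with hm
          · rw [withWord_eq_empty (fun h' => hlt ((isBallot_erase h hm).1 h')), Set.ncard_empty]
            rfl
          · rfl
      · by_cases hm : true ∈ w
        · obtain ⟨h1, h2, h3, -, -⟩ := h.unbump hm
          rw [if_pos hm, ih h1, h3, ← h2]
          congr 1 <;> push_cast <;> ring
        -- With an empty second row `u = v`, and the step to `(u - 1, v + 1)` hits the wall `v = u +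
        -- 2`.
        · rw [if_neg hm, List.count_eq_zero_of_not_mem hm]
          have := walkPairs_add_two t ((w.count false : ℤ) - 1)
          rw [show (w.count false : ℤ) - 1 + 2 = w.count false + 1 by ring] at this
          simpa using this.symm

lemma noThreeCrossing_iff {m : ℕ} {p : ℕ → ℕ} {f : Fin m → Fin m}
    (hf : ∀ x : Fin m, p x = f x) (hp : ∀ x, m ≤ x → p x = x) :
    NoThreeCrossing p ↔ IsNoncrossingInvolution 3 f := by
  constructor
  · intro h T hT ho hc
    have hm := T.orderEmbOfFin_mem hT
    have h1 := hc _ (hm 0) _ (hm 1) (by simp)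
    have h2 := hc _ (hm 1) _ (hm 2) (by simp)
    have h3 := hc _ (hm 0) _ (hm 2) (by simp)
    have h01 : T.orderEmbOfFin hT 0 < T.orderEmbOfFin hT 1 := by simp
    have h12 : T.orderEmbOfFin hT 1 < T.orderEmbOfFin hT 2 := by simp
    simp only [Fin.lt_def, ← hf] at h01 h12 h1 h2 h3
    exact h _ _ _ h01 h12 h3.1 h1.2 h2.2
  · intro h a b c h1 h2 h3 h4 h5
    have hc : c < m := by
      by_contra hge
      rw [hp c (by omega)] at h5
      omega
    have hfa := hf ⟨a, by omega⟩
    have hfb := hf ⟨b, by omega⟩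
    have hfc := hf ⟨c, hc⟩
    refine h {⟨a, by omega⟩, ⟨b, by omega⟩, ⟨c, hc⟩} ?_ ?_ ?_
    · rw [Finset.card_eq_three]
      exact ⟨_, _, _, by simp; omega, by simp; omega, by simp; omega, rfl⟩
    · intro x hx
      simp only [Finset.mem_insert, Finset.mem_singleton] at hx
      rcases hx with rfl | rfl | rfl <;> simp only [Fin.lt_def] <;> simp only at hfa hfb hfc <;> omega
    · intro x hx y hy hxy
      simp only [Finset.mem_insert, Finset.mem_singleton] at hx hy
      rcases hx with rfl | rfl | rfl <;> rcases hy with rfl | rfl | rfl <;>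
        simp only [Fin.lt_def] at hxy ⊢ <;> simp only at hfa hfb hfc <;> omega

lemma card_noncrossingInvolution_three (m : ℕ) :
    Nat.card (NoncrossingInvolution 3 (Fin m)) = (withWord m []).ncard := by
  rw [← Nat.card_coe_set_eq]
  have hw : ∀ p, p ∈ withWord m [] ↔ IsPartial m 0 p ∧ NoThreeCrossing p := by
    intro p
    refine ⟨fun h => ⟨h.1, h.2.1⟩, fun h => ⟨h.1, h.2, ?_⟩⟩
    exact List.length_eq_zero_iff.1 (governs_word h.1 h.2).1
  have hlt : ∀ p : withWord m [], ∀ x, x < m → p.1 x < m := by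
    intro p x hx
    obtain ⟨h1, h2, -⟩ := p.2.1
    by_contra hge
    have := (h2 (p.1 x)).2 (by simpa using hge)
    rw [h1] at this
    omega
  have hge : ∀ p : withWord m [], ∀ x, m ≤ x → p.1 x = x := fun p x hx =>
    (p.2.1.2.1 x).2 (by simpa using hx)
  let ext : (Fin m → Fin m) → ℕ → ℕ := fun f x => if h : x < m then (f ⟨x, h⟩ : ℕ) else x
  have ext1 : ∀ f (x : Fin m), ext f x = f x := fun f x => by simp [ext]
  have ext2 : ∀ f x, m ≤ x → ext f x = x := fun f x hx => by simp [ext, hx]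
  have key : ∀ x : ℕ, m ≤ x ∨ ∃ y : Fin m, x = y := fun x => by
    by_cases h : x < m
    · exact Or.inr ⟨⟨x, h⟩, rfl⟩
    · exact Or.inl (by omega)
  refine Nat.card_congr
    { toFun := fun f => ⟨ext f.1, (hw _).2 ⟨⟨fun x => ?_, fun x => ?_, fun x _ _ => by omega⟩,
        (noThreeCrossing_iff (ext1 f.1) (ext2 f.1)).2 f.2.2⟩⟩
      invFun := fun p => ⟨fun x => ⟨p.1 x, hlt p x x.2⟩, ⟨fun x => ?_, fun x hx => ?_⟩,
        (noThreeCrossing_iff (fun _ => rfl) (hge p)).1 p.2.2.1⟩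
      left_inv := fun f => ?_
      right_inv := fun p => ?_ }
  · rcases key x with h | ⟨y, rfl⟩
    · rw [ext2 _ _ h, ext2 _ _ h]
    · rw [ext1, ext1, f.2.1.1]
  · rcases key x with h | ⟨y, rfl⟩
    · rw [ext2 _ _ h]; simpa using h
    · rw [ext1, ← Fin.ext_iff]
      have := f.2.1.2 y
      simp [this]
  · exact Fin.ext (p.2.1.1 x)
  · have h1 := (p.2.1.2.1 x).1 (Fin.ext_iff.1 hx)
    have := x.2
    simp at h1
    omega
  · apply Subtype.ext
    funext x
    exact Fin.ext (ext1 f.1 x)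
  · apply Subtype.ext
    funext x
    rcases key x with h | ⟨y, rfl⟩
    · exact (ext2 _ _ h).trans (hge p x h).symm
    · exact ext1 _ y

end PartialMatching

/-! ### The Catalan formula for `k = 3`. -/

theorem numMatchings_three (m : ℕ) : (numMatchings 3 m : ℤ) = LatticeWalk.walkPairs m 0 0 := by
  rw [numMatchings_eq, PartialMatching.card_noncrossingInvolution_three,
    PartialMatching.ncard_withWord m (w := []) (show True from trivial)]
  rfl

theorem theorem3 :
    (∀ k n : ℕ, numTangledNoIsolated k n =
      ∑ l ∈ Finset.range (n + 1), n.choose l * numMatchings k (2 * n - l)) ∧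
    (∀ n : ℕ, (numTangledNoIsolated 3 n : ℤ) =
      ∑ l ∈ (Finset.range (n + 1)).filter Even,
        (n.choose l : ℤ) *
          ((catalan ((2 * n - l) / 2) : ℤ) * (catalan ((2 * n - l) / 2 + 2) : ℤ) -
            (catalan ((2 * n - l) / 2 + 1) : ℤ) ^ 2)) := by
  refine ⟨numTangledNoIsolated_eq, fun n => ?_⟩
  rw [numTangledNoIsolated_eq, Finset.sum_filter]
  push_cast
  refine Finset.sum_congr rfl fun l hl => ?_
  have hl : l ≤ n := Nat.lt_succ_iff.1 (Finset.mem_range.1 hl)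
  rw [numMatchings_three]
  split_ifs with he
  · obtain ⟨m, hm⟩ : ∃ m, 2 * n - l = 2 * m := by
      obtain ⟨j, rfl⟩ := he
      exact ⟨n - j, by omega⟩
    rw [hm, Nat.mul_div_cancel_left m two_pos, LatticeWalk.walkPairs_two_mul]
  · rw [LatticeWalk.walkPairs_odd, mul_zero]
    rintro ⟨j, hj⟩
    exact he ⟨n - j, by omega⟩
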